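/- **Theorem 2.2.** There is an absolute constant $C>0$ such that the following holds. For every $n\ge 1$ let $K(n)\ge 1$ be an integer and let $p_n=(p_n(i))_{1\le i\le K(n)}$ be a nonuniform probability distribution on $\{1,\dots,K(n)\}$ (that is, the numbers $p_n(i)$ are nonnegative, sum to $1$ and are not all equal), and let $X_{1,n},\dots,X_{n,n}$ be independent random variables on a probability space $(\Omega,\mathbb P)$ with $\mathbb P(X_{k,n}=i)=p_n(i)$ for $1\le k\le n$, $1\le i\le K(n)$. With the convention $0\ln 0=0$ put $$H_n=-\sum_{i=1}^{K(n)}p_n(i)\ln p_n(i),\qquad \sigma_n^2=\sum_{i=1}^{K(n)}p_n(i)\ln^2p_n(i)-\Big(\sum_{i=1}^{K(n)}p_n(i)\ln p_n(i)\Big)^2,\quad \sigma_n\ge 0,$$ $$\hat p_n(i)=\frac1n\sum_{j=1}^n \mathbf 1_{\{X_{j,n}=i\}},\qquad \hat H_n=-\sum_{i=1}^{K(n)}\hat p_n(i)\ln\hat p_n(i),\qquad T_{1,n}=\sum_{i=1}^{K(n)}\big(\mathbf 1_{\{X_{1,n}=i\}}-p_n(i)\big)\ln p_n(i),$$ where terms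 with $p_n(i)=0$ are omitted in $T_{1,n}$. Assume that, as $n\to\infty$, $$K(n)\to\infty,\qquad K(n)=o(\sqrt n\,\sigma_n),\qquad \frac{\sqrt n\,\sigma_n}{\ln n}\to\infty .$$ Then for every $0\le\delta\le1$ and every $n\ge1$ with $\sigma_n>0$ (which is automatic when all $p_n(i)$ are positive), $$\sup_{x\in\mathbb R}\left|\mathbb P\left(\frac{\sqrt n}{\sigma_n}(\hat H_n-H_n)\le x\right)-\Phi(x)\right|\le C\left(\frac{\mathbb E|T_{1,n}|^{2+\delta}}{n^{\delta/2}\sigma_n^{2+\delta}}+\sqrt{\frac{K(n)}{\sqrt n\,\sigma_n}}\right),$$ where $\Phi$ is the standard normal distribution function. -/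

import Mathlib

open MeasureTheory ProbabilityTheory Filter Topology Asymptotics

namespace PlugInEntropy

noncomputable section

/-- Shannon's entropy `-∑_{i=1}^K p(i) ln p(i)`, with the convention `0 ln 0 = 0`
(in Lean, `Real.log 0 = 0`). -/
def entropy (K : ℕ) (p : ℕ → ℝ) : ℝ :=
  -∑ i ∈ Finset.Icc 1 K, p i * Real.log (p i)

/-- `σ = √(Var (ln p(X)))` for `X` with law `p` on `{1, …, K}`, where
`Var (ln p(X)) = ∑ p(i) ln² p(i) - (∑ p(i) ln p(i))²`. -/
def sigma (K : ℕ) (p : ℕ → ℝ) : ℝ :=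
  Real.sqrt (∑ i ∈ Finset.Icc 1 K, p i * Real.log (p i) ^ 2
    - (∑ i ∈ Finset.Icc 1 K, p i * Real.log (p i)) ^ 2)

/-- The indicator `I_{X = i}` as a real-valued random variable. -/
def ind {Ω : Type*} (X : Ω → ℕ) (i : ℕ) (ω : Ω) : ℝ :=
  if X ω = i then 1 else 0

/-- The empirical distribution `p̂_n(i) = (1/n) ∑_{j=1}^n I_{X_j = i}` of a sample
`X_1, …, X_n`. -/
def empirical {Ω : Type*} (n : ℕ) (X : ℕ → Ω → ℕ) (i : ℕ) (ω : Ω) : ℝ :=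
  (1 / (n : ℝ)) * ∑ j ∈ Finset.Icc 1 n, ind (X j) i ω

/-- The plug-in estimator `Ĥ_n = -∑_{i=1}^K p̂_n(i) ln p̂_n(i)`. -/
def plugIn {Ω : Type*} (n K : ℕ) (X : ℕ → Ω → ℕ) (ω : Ω) : ℝ :=
  entropy K (fun i => empirical n X i ω)

/-- The variable `T = ∑_{i=1}^K (I_{X = i} - p(i)) ln p(i)`. -/
def centeredLog {Ω : Type*} (K : ℕ) (p : ℕ → ℝ) (X : Ω → ℕ) (ω : Ω) : ℝ :=
  ∑ i ∈ Finset.Icc 1 K, (ind X i ω - p i) * Real.log (p i)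

/-- `p` is a nonuniform probability distribution on `{1, …, K}`. -/
structure IsNonuniformDistribution (K : ℕ) (p : ℕ → ℝ) : Prop where
  nonneg : ∀ i ∈ Finset.Icc 1 K, 0 ≤ p i
  sum_eq_one : ∑ i ∈ Finset.Icc 1 K, p i = 1
  nonuniform : ∃ i ∈ Finset.Icc 1 K, ∃ j ∈ Finset.Icc 1 K, p i ≠ p j

/-- `X_1, …, X_n` are independent random variables, each with `P(X_k = i) = p(i)` for
`1 ≤ i ≤ K`. -/
structure IsIIDSample {Ω : Type*} [MeasurableSpace Ω] (P : Measure Ω) (n K : ℕ) (p : ℕ → ℝ)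
    (X : ℕ → Ω → ℕ) : Prop where
  measurable : ∀ k ∈ Finset.Icc 1 n, Measurable (X k)
  indep : iIndepFun (fun k : Finset.Icc 1 n => X k) P
  law : ∀ k ∈ Finset.Icc 1 n, ∀ i ∈ Finset.Icc 1 K, P.real {ω | X k ω = i} = p i

/-- The growth condition `K(n) → ∞`, `K(n) = o(√n σ_n)`, `√n σ_n / ln n → ∞`. -/
structure GrowthCondition (K : ℕ → ℕ) (p : ℕ → ℕ → ℝ) : Prop where
  tendsto_alphabet : Tendsto K atTop atTop
  isLittleO : (fun n => (K n : ℝ)) =o[atTop] (fun n => √(n : ℝ) * sigma (K n) (p n))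
  tendsto_div_log :
    Tendsto (fun n : ℕ => √(n : ℝ) * sigma (K n) (p n) / Real.log n) atTop atTop

end

end PlugInEntropy

/-! The error of the plug-in estimator splits exactly as `Ĥ - H = -(1/n) ∑ T_j - D(p̂ ‖ p)`, a
centred i.i.d. sum minus a relative entropy (`plugIn_sub_entropy`). Almost surely `0 ≤ D ≤ χ²(p̂,
p)`, and `E χ² ≤ K/n` because dividing by `p i` cancels the factor `p i` of the variance of `p̂ i`
(`integral_chiSq_le`). After scaling by `√n/σ`, the estimator lies between `W - R` and `W`, where
`W` is the normalized sum and `E R ≤ r = K/(√n σ)`. Markov's inequality at level `√r`, together with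
the fact that `Φ` is 1-Lipschitz, costs `2√r` in Kolmogorov distance
(`abs_measureReal_sub_normalCDF_le`).

The law of `W` is handled by `berry_esseen`, proved by Stein's method. Its error is `∑ E ξ² min(1,
|ξ|)`, and since `min(1, |x|) ≤ |x|^δ` for every `δ ∈ [0, 1]`, this one quantity serves all
exponents at once. In Stein's method `P(W ≤ z) - Φ z` equals `E[f'(W) - W f(W)]`, where `f` solves
Stein's equation. Independence allows each `ξ i` to be compared with the sum `V` of the others,
which leaves increments of `f'`. These are small except when `V` is within `|ξ i|` of the jump at
`z`, and a concentration inequality (`measureReal_mem_Icc_sum_le`) bounds the probability of that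
event. -/

namespace SteinMethod

/-! ### The standard normal distribution function -/

/-- The standard normal density. -/
noncomputable abbrev normalPDF (x : ℝ) : ℝ := gaussianPDFReal 0 1 x

/-- The standard normal distribution function. -/
noncomputable abbrev normalCDF (x : ℝ) : ℝ := cdf (gaussianReal 0 1) x

lemma normalPDF_eq (x : ℝ) : normalPDF x = (√(2 * Real.pi))⁻¹ * Real.exp (-x ^ 2 / 2) := by
  simp [normalPDF, gaussianPDFReal]

lemma normalPDF_pos (x : ℝ) : 0 < normalPDF x := gaussianPDFReal_pos 0 1 x one_ne_zero

lemma normalPDF_neg (x : ℝ) : normalPDF (-x) = normalPDF x := by simp [normalPDF_eq]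

lemma continuous_normalPDF : Continuous normalPDF := by
  have : normalPDF = fun x => (√(2 * Real.pi))⁻¹ * Real.exp (-x ^ 2 / 2) := funext normalPDF_eq
  rw [this]
  fun_prop

lemma hasDerivAt_normalPDF (x : ℝ) : HasDerivAt normalPDF (-x * normalPDF x) x := by
  have h : normalPDF = fun x => (√(2 * Real.pi))⁻¹ * Real.exp (-x ^ 2 / 2) := funext normalPDF_eq
  have h1 : HasDerivAt (fun x : ℝ => -x ^ 2 / 2) (-x) x := by
    have := ((hasDerivAt_pow 2 x).neg).div_const 2
    refine this.congr_deriv ?_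
    push_cast
    ring
  have h2 := (h1.exp).const_mul (√(2 * Real.pi))⁻¹
  rw [h]
  refine h2.congr_deriv ?_
  ring

lemma one_div_three_le_normalPDF_zero : 1 / 3 ≤ normalPDF 0 := by
  rw [normalPDF_eq]
  simp only [ne_eq, OfNat.ofNat_ne_zero, not_false_eq_true, zero_pow, neg_zero, zero_div,
    Real.exp_zero, mul_one]
  rw [one_div]
  refine inv_anti₀ (by positivity) ?_
  rw [Real.sqrt_le_left (by norm_num)]
  nlinarith [Real.pi_lt_four]

lemma normalPDF_le_one (x : ℝ) : normalPDF x ≤ 1 := by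
  rw [normalPDF_eq]
  have h1 : (√(2 * Real.pi))⁻¹ ≤ 1 := by
    refine inv_le_one_of_one_le₀ ?_
    rw [Real.one_le_sqrt]
    nlinarith [Real.pi_gt_three]
  have h2 : Real.exp (-x ^ 2 / 2) ≤ 1 := Real.exp_le_one_iff.2 (by nlinarith [sq_nonneg x])
  have h3 : 0 ≤ (√(2 * Real.pi))⁻¹ := by positivity
  have h4 := Real.exp_pos (-x ^ 2 / 2)
  nlinarith

lemma normalCDF_eq_integral (x : ℝ) : normalCDF x = ∫ t in Set.Iic x, normalPDF t := by
  rw [normalCDF, cdf_eq_real, measureReal_def, gaussianReal_apply_eq_integral _ one_ne_zero,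
    ENNReal.toReal_ofReal]
  exact integral_nonneg fun t => gaussianPDFReal_nonneg _ _ _

lemma hasDerivAt_normalCDF (x : ℝ) : HasDerivAt normalCDF (normalPDF x) x := by
  have hi : Integrable normalPDF := integrable_gaussianPDFReal 0 1
  have h : ∀ y, normalCDF y = normalCDF 0 + ∫ t in (0 : ℝ)..y, normalPDF t := by
    intro y
    rw [normalCDF_eq_integral, normalCDF_eq_integral, ← intervalIntegral.integral_Iic_sub_Iic
      hi.integrableOn hi.integrableOn]
    ring
  have h1 : HasDerivAt (fun y => ∫ t in (0 : ℝ)..y, normalPDF t) (normalPDF x) x :=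
    intervalIntegral.integral_hasDerivAt_right (hi.intervalIntegrable)
      (continuous_normalPDF.stronglyMeasurableAtFilter _ _) continuous_normalPDF.continuousAt
  have h2 := h1.const_add (normalCDF 0)
  exact h2.congr_of_eventuallyEq (Eventually.of_forall h)

lemma normalCDF_nonneg (x : ℝ) : 0 ≤ normalCDF x := cdf_nonneg _ x

lemma normalCDF_le_one (x : ℝ) : normalCDF x ≤ 1 := cdf_le_one _ x

lemma normalCDF_mono : Monotone normalCDF := monotone_cdf _

lemma normalCDF_add_le (x : ℝ) {h : ℝ} (hh : 0 ≤ h) : normalCDF (x + h) ≤ normalCDF x + h := by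
  have := Convex.norm_image_sub_le_of_norm_hasDerivWithin_le (f := normalCDF) (f' := normalPDF)
    (s := Set.univ) (C := 1) (x := x) (y := x + h)
    (fun y _ => (hasDerivAt_normalCDF y).hasDerivWithinAt)
    (fun y _ => by rw [Real.norm_of_nonneg (normalPDF_pos y).le]; exact normalPDF_le_one y)
    convex_univ (Set.mem_univ _) (Set.mem_univ _)
  rw [add_sub_cancel_left, Real.norm_of_nonneg hh, one_mul] at this
  linarith [Real.le_norm_self (normalCDF (x + h) - normalCDF x)]

/-- The density is even, so `Φ(-y) + Φ(y)` has zero derivative; its limit at infinity is 1. -/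
lemma normalCDF_neg (x : ℝ) : normalCDF (-x) = 1 - normalCDF x := by
  have hd : ∀ y, HasDerivAt (fun y => normalCDF (-y) + normalCDF y) 0 y := by
    intro y
    have h1 : HasDerivAt (fun y => normalCDF (-y)) (normalPDF (-y) * -1) y :=
      (hasDerivAt_normalCDF (-y)).comp y (hasDerivAt_neg y)
    have h2 := h1.add (hasDerivAt_normalCDF y)
    rw [normalPDF_neg] at h2
    refine h2.congr_deriv ?_
    ring
  have hconst : ∀ y, normalCDF (-y) + normalCDF y = normalCDF (-x) + normalCDF x := fun y =>
    is_const_of_deriv_eq_zero (fun y => (hd y).differentiableAt) (fun y => (hd y).deriv) y x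
  have hlim : Tendsto (fun y => normalCDF (-y) + normalCDF y) atTop (𝓝 (0 + 1)) :=
    ((tendsto_cdf_atBot _).comp tendsto_neg_atTop_atBot).add (tendsto_cdf_atTop _)
  have hlim' : Tendsto (fun y => normalCDF (-y) + normalCDF y) atTop
      (𝓝 (normalCDF (-x) + normalCDF x)) := by
    simp_rw [hconst]
    exact tendsto_const_nhds
  have := tendsto_nhds_unique hlim hlim'
  linarith

/-! ### Mills ratio -/

/-- The Mills ratio of the standard normal distribution. -/
noncomputable def millsRatio (w : ℝ) : ℝ := (1 - normalCDF w) / normalPDF w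

lemma millsRatio_nonneg (w : ℝ) : 0 ≤ millsRatio w :=
  div_nonneg (by linarith [normalCDF_le_one w]) (normalPDF_pos w).le

lemma hasDerivAt_millsRatio (w : ℝ) : HasDerivAt millsRatio (w * millsRatio w - 1) w := by
  have h := ((hasDerivAt_normalCDF w).const_sub 1).div (hasDerivAt_normalPDF w) (normalPDF_pos w).ne'
  refine h.congr_deriv ?_
  have := (normalPDF_pos w).ne'
  rw [millsRatio]
  field_simp
  ring

/-- The function `φ(y)/y - (1 - Φ(y))` has derivative `-φ(y)/y²` and tends to 0 at infinity, hence
is nonnegative on the positive axis. -/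
lemma mul_millsRatio_le_one {w : ℝ} (hw : 0 ≤ w) : w * millsRatio w ≤ 1 := by
  rcases hw.eq_or_lt with rfl | hw
  · simp
  have hd : ∀ y ∈ Set.Ioi (0 : ℝ), HasDerivAt (fun y => normalPDF y / y - (1 - normalCDF y))
      (-(normalPDF y / y ^ 2)) y := by
    intro y hy
    have hy' : y ≠ 0 := (Set.mem_Ioi.1 hy).ne'
    have h := ((hasDerivAt_normalPDF y).div (hasDerivAt_id y) hy').sub
      ((hasDerivAt_normalCDF y).const_sub 1)
    refine h.congr_deriv ?_
    simp only [id]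
    field_simp
    ring
  have hanti : AntitoneOn (fun y => normalPDF y / y - (1 - normalCDF y)) (Set.Ioi 0) := by
    refine antitoneOn_of_deriv_nonpos (convex_Ioi 0)
      (fun y hy => (hd y hy).continuousAt.continuousWithinAt) ?_ ?_
    · rw [interior_Ioi]
      exact fun y hy => (hd y hy).differentiableAt.differentiableWithinAt
    · rw [interior_Ioi]
      intro y hy
      rw [(hd y hy).deriv]
      have := normalPDF_pos y
      have : 0 ≤ normalPDF y / y ^ 2 := by positivity
      linarith
  have hlim : Tendsto (fun y => normalPDF y / y - (1 - normalCDF y)) atTop (𝓝 (0 - (1 - 1))) := by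
    refine Tendsto.sub ?_ ((tendsto_cdf_atTop _).const_sub 1)
    refine tendsto_of_tendsto_of_tendsto_of_le_of_le' tendsto_const_nhds tendsto_inv_atTop_zero
      ?_ ?_
    · filter_upwards [eventually_gt_atTop 0] with y hy
      exact div_nonneg (normalPDF_pos y).le hy.le
    · filter_upwards [eventually_gt_atTop 0] with y hy
      rw [← one_div]
      exact div_le_div_of_nonneg_right (normalPDF_le_one y) hy.le
  have hge : (0 : ℝ) - (1 - 1) ≤ normalPDF w / w - (1 - normalCDF w) := by
    refine le_of_tendsto hlim ?_
    filter_upwards [eventually_ge_atTop w] with y hy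
    exact hanti hw (hw.trans_le hy) hy
  have h1 : 1 - normalCDF w ≤ normalPDF w / w := by linarith
  rw [le_div_iff₀ hw] at h1
  rw [millsRatio, ← mul_div_assoc, div_le_one (normalPDF_pos w)]
  linarith

/-- The derivative `w M(w) - 1` is nonpositive for `w ≥ 0`, so the maximum is `M(0) ≤ 1/φ(0) ≤ 3`.
-/
lemma millsRatio_le_three {w : ℝ} (hw : 0 ≤ w) : millsRatio w ≤ 3 := by
  have hanti : AntitoneOn millsRatio (Set.Ici 0) := by
    refine antitoneOn_of_deriv_nonpos (convex_Ici 0)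
      (fun y _ => (hasDerivAt_millsRatio y).continuousAt.continuousWithinAt)
      (fun y _ => (hasDerivAt_millsRatio y).differentiableAt.differentiableWithinAt) ?_
    rw [interior_Ici]
    intro y hy
    rw [(hasDerivAt_millsRatio y).deriv]
    linarith [mul_millsRatio_le_one (Set.mem_Ioi.1 hy).le]
  refine (hanti (Set.mem_Ici.2 le_rfl) hw hw).trans ?_
  rw [millsRatio, div_le_iff₀ (normalPDF_pos 0)]
  linarith [normalCDF_nonneg 0, one_div_three_le_normalPDF_zero]

/-! ### The solution of Stein's equation -/

/-- The bounded solution of `f' w - w * f w = 1_{w ≤ z} - Φ z`. -/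
noncomputable def steinSol (z w : ℝ) : ℝ :=
  if w ≤ z then millsRatio (-w) * (1 - normalCDF z) else millsRatio w * normalCDF z

/-- The derivative of `steinSol z` away from `z`, extended by Stein's equation. -/
noncomputable def steinDeriv (z w : ℝ) : ℝ :=
  w * steinSol z w + (if w ≤ z then 1 else 0) - normalCDF z

lemma millsRatio_neg (w : ℝ) : millsRatio (-w) = normalCDF w / normalPDF w := by
  rw [millsRatio, normalCDF_neg, normalPDF_neg]
  ring

lemma steinSol_nonneg (z w : ℝ) : 0 ≤ steinSol z w := by
  rw [steinSol]
  split_ifs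
  · exact mul_nonneg (millsRatio_nonneg _) (by linarith [normalCDF_le_one z])
  · exact mul_nonneg (millsRatio_nonneg _) (normalCDF_nonneg z)

/-- Reduces the bounds on `f` and on `w f(w)` to those on the Mills ratio. When the branch in force
is the one with the large ratio, monotonicity of `Φ` between `w` and `z` supplies the missing small
factor. -/
lemma steinSol_le_millsRatio_abs (z w : ℝ) : steinSol z w ≤ millsRatio |w| := by
  have hz0 := normalCDF_nonneg z
  have hz1 := normalCDF_le_one z
  have hw0 := normalCDF_nonneg w
  have hw1 := normalCDF_le_one w
  have hp := normalPDF_pos w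
  rw [steinSol]
  rcases le_total 0 w with hw | hw
  · rw [abs_of_nonneg hw]
    split_ifs with h
    · have := normalCDF_mono h
      rw [millsRatio_neg, millsRatio, div_mul_eq_mul_div]
      gcongr
      nlinarith
    · exact mul_le_of_le_one_right (millsRatio_nonneg _) hz1
  · rw [abs_of_nonpos hw]
    split_ifs with h
    · exact mul_le_of_le_one_right (millsRatio_nonneg _) (by linarith)
    · have := normalCDF_mono (not_le.1 h).le
      rw [millsRatio_neg, millsRatio, div_mul_eq_mul_div]
      gcongr
      nlinarith

lemma abs_steinSol_le (z w : ℝ) : |steinSol z w| ≤ 3 := by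
  rw [abs_of_nonneg (steinSol_nonneg z w)]
  exact (steinSol_le_millsRatio_abs z w).trans (millsRatio_le_three (abs_nonneg w))

lemma abs_mul_steinSol_le (z w : ℝ) : |w * steinSol z w| ≤ 1 := by
  rw [abs_mul, abs_of_nonneg (steinSol_nonneg z w)]
  exact (mul_le_mul_of_nonneg_left (steinSol_le_millsRatio_abs z w) (abs_nonneg w)).trans
    (mul_millsRatio_le_one (abs_nonneg w))

lemma abs_steinDeriv_le (z w : ℝ) : |steinDeriv z w| ≤ 2 := by
  have h1 := abs_le.1 (abs_mul_steinSol_le z w)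
  have h2 := normalCDF_nonneg z
  have h3 := normalCDF_le_one z
  rw [steinDeriv, abs_le]
  split_ifs <;> constructor <;> linarith

lemma hasDerivAt_left_branch (z w : ℝ) :
    HasDerivAt (fun w => millsRatio (-w) * (1 - normalCDF z))
      (w * (millsRatio (-w) * (1 - normalCDF z)) + 1 - normalCDF z) w := by
  have h := ((hasDerivAt_millsRatio (-w)).comp w (hasDerivAt_neg w)).mul_const (1 - normalCDF z)
  refine h.congr_deriv ?_
  ring

lemma hasDerivAt_right_branch (z w : ℝ) :
    HasDerivAt (fun w => millsRatio w * normalCDF z)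
      (w * (millsRatio w * normalCDF z) - normalCDF z) w := by
  refine ((hasDerivAt_millsRatio w).mul_const (normalCDF z)).congr_deriv ?_
  ring

lemma hasDerivAt_steinSol {z w : ℝ} (h : w ≠ z) : HasDerivAt (steinSol z) (steinDeriv z w) w := by
  rcases lt_or_gt_of_ne h with h | h
  · refine ((hasDerivAt_left_branch z w).congr_of_eventuallyEq ?_).congr_deriv ?_
    · filter_upwards [Iio_mem_nhds h] with y hy
      rw [steinSol, if_pos (Set.mem_Iio.1 hy).le]
    · rw [steinDeriv, steinSol, if_pos h.le, if_pos h.le]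
  · refine ((hasDerivAt_right_branch z w).congr_of_eventuallyEq ?_).congr_deriv ?_
    · filter_upwards [Ioi_mem_nhds h] with y hy
      rw [steinSol, if_neg (not_le.2 (Set.mem_Ioi.1 hy))]
    · rw [steinDeriv, steinSol, if_neg (not_le.2 h), if_neg (not_le.2 h), add_zero]

lemma continuous_steinSol (z : ℝ) : Continuous (steinSol z) := by
  refine Continuous.if_le ?_ ?_ continuous_id continuous_const ?_
  · exact continuous_iff_continuousAt.2 fun w => (hasDerivAt_left_branch z w).continuousAt
  · exact continuous_iff_continuousAt.2 fun w => (hasDerivAt_right_branch z w).continuousAt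
  · rintro w (rfl : w = z)
    rw [millsRatio_neg, millsRatio]
    ring

lemma measurable_steinDeriv (z : ℝ) : Measurable (steinDeriv z) := by
  refine ((measurable_id.mul (continuous_steinSol z).measurable).add ?_).sub_const _
  exact Measurable.ite measurableSet_Iic measurable_const measurable_const

/-! ### Increments and first-order remainder of the Stein solution -/

lemma steinSol_lipschitz_of_notMem {z x y : ℝ} (hxy : x ≤ y) (h : z ∉ Set.Ioo x y) :
    |steinSol z y - steinSol z x| ≤ 2 * (y - x) := by
  rcases hxy.eq_or_lt with rfl | hlt
  · simp
  obtain ⟨c, hc, he⟩ := exists_hasDerivAt_eq_slope (steinSol z) (steinDeriv z) hlt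
    (continuous_steinSol z).continuousOn
    (fun w hw => hasDerivAt_steinSol (fun e => h (e ▸ hw)))
  have h1 := abs_steinDeriv_le z c
  rwa [he, abs_div, div_le_iff₀ (abs_pos.2 (sub_pos.2 hlt).ne'),
    abs_of_pos (sub_pos.2 hlt)] at h1

lemma steinSol_lipschitz_of_le {z x y : ℝ} (hxy : x ≤ y) :
    |steinSol z y - steinSol z x| ≤ 2 * (y - x) := by
  by_cases h : z ∈ Set.Ioo x y
  · have h1 := steinSol_lipschitz_of_notMem (z := z) h.1.le (by simp)
    have h2 := steinSol_lipschitz_of_notMem (z := z) h.2.le (by simp)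
    have h3 := abs_sub_le (steinSol z y) (steinSol z z) (steinSol z x)
    linarith
  · exact steinSol_lipschitz_of_notMem hxy h

lemma steinSol_lipschitz (z x y : ℝ) : |steinSol z y - steinSol z x| ≤ 2 * |y - x| := by
  rcases le_total x y with h | h
  · rw [abs_of_nonneg (sub_nonneg.2 h)]
    exact steinSol_lipschitz_of_le h
  · rw [abs_sub_comm, abs_sub_comm y x, abs_of_nonneg (sub_nonneg.2 h)]
    exact steinSol_lipschitz_of_le h

/-- The modulus controlling the increments of `steinDeriv z`. -/
noncomputable def steinModulus (z w u : ℝ) : ℝ :=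
  4 * min 1 (|u| * (|w| + 1) + if |w - z| ≤ |u| then 1 else 0)

lemma abs_mul_steinSol_sub_le (z w u : ℝ) :
    |(w + u) * steinSol z (w + u) - w * steinSol z w| ≤ 3 * (|u| * (|w| + 1)) := by
  have h1 := steinSol_lipschitz z w (w + u)
  rw [add_sub_cancel_left] at h1
  have h2 := abs_steinSol_le z (w + u)
  have h3 : (w + u) * steinSol z (w + u) - w * steinSol z w
      = w * (steinSol z (w + u) - steinSol z w) + u * steinSol z (w + u) := by ring
  rw [h3]
  refine (abs_add_le _ _).trans ?_
  rw [abs_mul, abs_mul]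
  have h4 := mul_le_mul_of_nonneg_left h1 (abs_nonneg w)
  have h5 := mul_le_mul_of_nonneg_left h2 (abs_nonneg u)
  nlinarith [mul_nonneg (abs_nonneg w) (abs_nonneg u)]

lemma indicator_eq_of_lt {z w u : ℝ} (h : |u| < |w - z|) :
    (if w + u ≤ z then (1 : ℝ) else 0) = if w ≤ z then 1 else 0 := by
  have hiff : w + u ≤ z ↔ w ≤ z := by
    have hu := abs_le.1 (le_refl |u|)
    rcases lt_abs.1 h with h | h
    · exact iff_of_false (by linarith) (by linarith [abs_nonneg u])
    · exact iff_of_true (by linarith) (by linarith [abs_nonneg u])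
  simp only [hiff]

/-- The bound 4 is twice the bound on `f'`. The other one uses Stein's equation: an increment of
`f'` is one of `w f(w)`, which is Lipschitz with a constant of order `|w| + 1`, plus the jump of the
indicator if `z` is within reach. -/
lemma abs_steinDeriv_sub_le (z w u : ℝ) :
    |steinDeriv z (w + u) - steinDeriv z w| ≤ steinModulus z w u := by
  rw [steinModulus, mul_min_of_nonneg _ _ (by norm_num : (0 : ℝ) ≤ 4)]
  have hA : 0 ≤ |u| * (|w| + 1) := by positivity
  refine le_min ?_ ?_
  · refine (abs_sub _ _).trans ?_
    linarith [abs_steinDeriv_le z (w + u), abs_steinDeriv_le z w]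
  · have h1 := abs_mul_steinSol_sub_le z w u
    have h3 : steinDeriv z (w + u) - steinDeriv z w
        = ((w + u) * steinSol z (w + u) - w * steinSol z w)
          + ((if w + u ≤ z then (1 : ℝ) else 0) - if w ≤ z then 1 else 0) := by
      rw [steinDeriv, steinDeriv]; ring
    rw [h3]
    refine (abs_add_le _ _).trans ?_
    by_cases h : |w - z| ≤ |u|
    · rw [if_pos h]
      have : |(if w + u ≤ z then (1 : ℝ) else 0) - if w ≤ z then 1 else 0| ≤ 1 := by
        split_ifs <;> norm_num
      linarith
    · rw [indicator_eq_of_lt (not_le.1 h), if_neg h, sub_self, abs_zero]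
      linarith

lemma abs_steinSol_taylor_le (z w u : ℝ) :
    |steinSol z (w + u) - steinSol z w - u * steinDeriv z w| ≤ |u| * steinModulus z w u := by
  have hcrude : |steinSol z (w + u) - steinSol z w - u * steinDeriv z w| ≤ |u| * 4 := by
    refine (abs_sub _ _).trans ?_
    have h1 := steinSol_lipschitz z w (w + u)
    rw [add_sub_cancel_left] at h1
    rw [abs_mul]
    have := mul_le_mul_of_nonneg_left (abs_steinDeriv_le z w) (abs_nonneg u)
    linarith
  rw [steinModulus]
  have hA : 0 ≤ |u| * (|w| + 1) := by positivity
  by_cases h : |w - z| ≤ |u|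
  -- Close to the jump the modulus is exactly 4, so the crude bound suffices; away from it the
  -- segment avoids `z` and the mean value inequality applies.
  · rw [if_pos h, min_eq_left (by linarith), mul_one]
    exact hcrude
  rw [if_neg h, add_zero, mul_min_of_nonneg _ _ (by norm_num : (0 : ℝ) ≤ 4), mul_one,
    mul_min_of_nonneg _ _ (abs_nonneg u)]
  refine le_min hcrude ?_
  have hlt := not_le.1 h
  have hseg : ∀ t ∈ Set.uIcc (0 : ℝ) u, |t| ≤ |u| := fun t ht => by
    have := Set.abs_sub_left_of_mem_uIcc ht
    simpa using this
  have hd : ∀ t ∈ Set.uIcc (0 : ℝ) u,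
      HasDerivWithinAt (fun t => steinSol z (w + t) - t * steinDeriv z w)
        (steinDeriv z (w + t) - steinDeriv z w) (Set.uIcc 0 u) t := by
    intro t ht
    have hne : w + t ≠ z := by
      intro e
      have h1 := hseg t ht
      have : t = -(w - z) := by linarith
      rw [this, abs_neg] at h1
      linarith
    have h1 : HasDerivAt (fun t => steinSol z (w + t)) (steinDeriv z (w + t)) t :=
      HasDerivAt.comp_const_add w t (hasDerivAt_steinSol hne)
    have h2 := h1.sub ((hasDerivAt_id t).mul_const (steinDeriv z w))
    simp only [one_mul, id] at h2
    exact h2.hasDerivWithinAt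
  have hbd : ∀ t ∈ Set.uIcc (0 : ℝ) u,
      ‖steinDeriv z (w + t) - steinDeriv z w‖ ≤ 4 * (|u| * (|w| + 1)) := by
    intro t ht
    rw [Real.norm_eq_abs]
    have h1 := hseg t ht
    refine (abs_steinDeriv_sub_le z w t).trans ?_
    rw [steinModulus, if_neg (by linarith), add_zero]
    have h2 : |t| * (|w| + 1) ≤ |u| * (|w| + 1) := by gcongr
    linarith [min_le_right 1 (|t| * (|w| + 1))]
  have := Convex.norm_image_sub_le_of_norm_hasDerivWithin_le hd hbd (convex_uIcc 0 u)
    Set.left_mem_uIcc Set.right_mem_uIcc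
  simp only [Real.norm_eq_abs, add_zero, zero_mul, sub_zero] at this
  calc _ = |steinSol z (w + u) - u * steinDeriv z w - steinSol z w| := by congr 1; ring
    _ ≤ _ := this
    _ = _ := by ring

lemma steinModulus_nonneg (z w u : ℝ) : 0 ≤ steinModulus z w u :=
  (abs_nonneg _).trans (abs_steinDeriv_sub_le z w u)

lemma steinModulus_le_four (z w u : ℝ) : steinModulus z w u ≤ 4 := by
  rw [steinModulus]
  linarith [min_le_left 1 (|u| * (|w| + 1) + if |w - z| ≤ |u| then 1 else 0)]

lemma measurable_steinModulus (z : ℝ) :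
    Measurable (fun q : ℝ × ℝ => steinModulus z q.1 q.2) := by
  refine Measurable.const_mul (Measurable.min measurable_const (Measurable.add (by fun_prop) ?_)) 4
  exact Measurable.ite (measurableSet_le (by fun_prop) (by fun_prop)) measurable_const
    measurable_const

end SteinMethod

namespace SteinMethod

variable {Ω ι : Type*} [MeasurableSpace Ω] {P : Measure Ω}

/-! ### Bounded random variables -/

/-- A bounded real-valued random variable. -/
structure IsBddRV (f : Ω → ℝ) : Prop where
  measurable : Measurable f
  bdd : ∃ C, ∀ ω, |f ω| ≤ C

namespace IsBddRV

variable {f g : Ω → ℝ}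

lemma const (c : ℝ) : IsBddRV (fun _ : Ω => c) := ⟨measurable_const, |c|, fun _ => le_rfl⟩

lemma add (hf : IsBddRV f) (hg : IsBddRV g) : IsBddRV (fun ω => f ω + g ω) := by
  obtain ⟨C, hC⟩ := hf.bdd
  obtain ⟨D, hD⟩ := hg.bdd
  exact ⟨hf.measurable.add hg.measurable, C + D, fun ω =>
    (abs_add_le _ _).trans (add_le_add (hC ω) (hD ω))⟩

lemma mul (hf : IsBddRV f) (hg : IsBddRV g) : IsBddRV (fun ω => f ω * g ω) := by
  obtain ⟨C, hC⟩ := hf.bdd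
  obtain ⟨D, hD⟩ := hg.bdd
  exact ⟨hf.measurable.mul hg.measurable, C * D, fun ω => by
    rw [abs_mul]
    exact mul_le_mul (hC ω) (hD ω) (abs_nonneg _) ((abs_nonneg _).trans (hC ω))⟩

lemma sub (hf : IsBddRV f) (hg : IsBddRV g) : IsBddRV (fun ω => f ω - g ω) := by
  simpa [sub_eq_add_neg] using hf.add ((const (-1)).mul hg)

lemma sq (hf : IsBddRV f) : IsBddRV (fun ω => f ω ^ 2) := by
  simpa [pow_two] using hf.mul hf

lemma abs (hf : IsBddRV f) : IsBddRV (fun ω => |f ω|) := by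
  obtain ⟨C, hC⟩ := hf.bdd
  exact ⟨hf.measurable.abs, C, fun ω => by rw [abs_abs]; exact hC ω⟩

lemma min_const (hf : IsBddRV f) (c : ℝ) : IsBddRV (fun ω => min c (f ω)) := by
  obtain ⟨C, hC⟩ := hf.bdd
  refine ⟨measurable_const.min hf.measurable, |c| + C, fun ω => ?_⟩
  have h1 := hC ω
  have h2 := abs_nonneg c
  have h3 := abs_nonneg (f ω)
  rcases min_choice c (f ω) with h | h <;> rw [h] <;> linarith

lemma sum {F : ι → Ω → ℝ} {s : Finset ι} (h : ∀ i ∈ s, IsBddRV (F i)) :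
    IsBddRV (fun ω => ∑ i ∈ s, F i ω) := by
  classical
  induction s using Finset.induction_on with
  | empty => simpa using const 0
  | insert i s hi ih =>
    simp only [Finset.sum_insert hi]
    exact (h i (Finset.mem_insert_self i s)).add
      (ih fun j hj => h j (Finset.mem_insert_of_mem hj))

lemma comp (hf : IsBddRV f) {φ : ℝ → ℝ} (hφ : Measurable φ) {C : ℝ} (hC : ∀ x, |φ x| ≤ C) :
    IsBddRV (fun ω => φ (f ω)) :=
  ⟨hφ.comp hf.measurable, C, fun ω => hC (f ω)⟩

lemma indicator {A : Set Ω} (hA : MeasurableSet A) : IsBddRV (A.indicator fun _ => (1 : ℝ)) := by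
  classical
  refine ⟨measurable_const.indicator hA, 1, fun ω => ?_⟩
  rw [Set.indicator_apply]
  split_ifs <;> simp

lemma integrable [IsFiniteMeasure P] (hf : IsBddRV f) : Integrable f P := by
  obtain ⟨C, hC⟩ := hf.bdd
  exact Integrable.of_bound hf.measurable.aestronglyMeasurable C (Eventually.of_forall hC)

lemma memLp [IsFiniteMeasure P] (hf : IsBddRV f) : MemLp f 2 P := by
  obtain ⟨C, hC⟩ := hf.bdd
  exact MemLp.of_bound hf.measurable.aestronglyMeasurable C (Eventually.of_forall hC)

end IsBddRV

/-! ### Independence -/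

lemma integral_mul_comp_of_indepFun {X Y : Ω → ℝ} (h : IndepFun X Y P) (hX : Measurable X)
    (hY : Measurable Y) {φ ψ : ℝ → ℝ} (hφ : Measurable φ) (hψ : Measurable ψ) :
    ∫ ω, φ (X ω) * ψ (Y ω) ∂P = (∫ ω, φ (X ω) ∂P) * ∫ ω, ψ (Y ω) ∂P :=
  h.integral_fun_comp_mul_comp hX.aemeasurable hY.aemeasurable hφ.aestronglyMeasurable
    hψ.aestronglyMeasurable

/-- Fubini on the product law: a bound on the mean over `V` that is uniform in the frozen value of
`X` survives integration in `X` against the weight `φ`. The weights needed are `1` and `x²`. -/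
lemma integral_le_of_indepFun [IsProbabilityMeasure P] {X V : Ω → ℝ} (h : IndepFun X V P)
    (hX : IsBddRV X) (hV : IsBddRV V) {φ H : ℝ → ℝ} {G : ℝ × ℝ → ℝ} (hφ : Measurable φ)
    (hφ0 : ∀ x, 0 ≤ φ x) (hφb : IsBddRV fun ω => φ (X ω)) (hG : Measurable G) {C : ℝ}
    (hGC : ∀ q, |G q| ≤ C) (hH : Measurable H) (hHb : IsBddRV fun ω => H (X ω))
    (hle : ∀ x, ∫ ω, G (V ω, x) ∂P ≤ H x) :
    ∫ ω, φ (X ω) * G (V ω, X ω) ∂P ≤ ∫ ω, φ (X ω) * H (X ω) ∂P := by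
  have hmap := (indepFun_iff_map_prod_eq_prod_map_map hX.measurable.aemeasurable
    hV.measurable.aemeasurable).1 h
  have hXV : Measurable fun ω => (X ω, V ω) := hX.measurable.prodMk hV.measurable
  have hF : Measurable fun q : ℝ × ℝ => φ q.1 * G (q.2, q.1) :=
    (hφ.comp measurable_fst).mul (hG.comp measurable_swap)
  have hint : IsBddRV fun ω => φ (X ω) * G (V ω, X ω) :=
    hφb.mul ⟨hG.comp (hV.measurable.prodMk hX.measurable), C, fun ω => hGC _⟩
  have hintF : Integrable (fun q : ℝ × ℝ => φ q.1 * G (q.2, q.1)) ((P.map X).prod (P.map V)) := by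
    rw [← hmap, integrable_map_measure hF.aestronglyMeasurable hXV.aemeasurable]
    exact hint.integrable
  have h1 : ∫ ω, φ (X ω) * G (V ω, X ω) ∂P
      = ∫ x, φ x * ∫ ω, G (V ω, x) ∂P ∂(P.map X) := by
    calc _ = ∫ q, φ q.1 * G (q.2, q.1) ∂(P.map fun ω => (X ω, V ω)) :=
          (integral_map hXV.aemeasurable hF.aestronglyMeasurable).symm
      _ = ∫ x, ∫ v, φ x * G (v, x) ∂(P.map V) ∂(P.map X) := by
          rw [hmap, integral_prod _ hintF]
      _ = _ := by
          congr 1 with x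
          rw [integral_const_mul, integral_map hV.measurable.aemeasurable]
          exact (hG.comp (measurable_id.prodMk measurable_const)).aestronglyMeasurable
  have h2 : ∫ ω, φ (X ω) * H (X ω) ∂P = ∫ x, φ x * H x ∂(P.map X) :=
    (integral_map hX.measurable.aemeasurable (hφ.mul hH).aestronglyMeasurable).symm
  rw [h1, h2]
  refine integral_mono ?_ ?_ fun x => mul_le_mul_of_nonneg_left (hle x) (hφ0 x)
  · refine (hintF.integral_prod_left).congr (Eventually.of_forall fun x => ?_)
    simp only
    rw [integral_const_mul, integral_map hV.measurable.aemeasurable]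
    exact (hG.comp (measurable_id.prodMk measurable_const)).aestronglyMeasurable
  · refine (integrable_map_measure (f := X) (g := fun x => φ x * H x)
      (hφ.mul hH).aestronglyMeasurable hX.measurable.aemeasurable).2 ?_
    exact (hφb.mul hHb).integrable

lemma integral_sum_sub_sq_le [IsProbabilityMeasure P] {Y : ι → Ω → ℝ} {s : Finset ι}
    (hb : ∀ i, IsBddRV (Y i)) (hind : iIndepFun Y P) :
    ∫ ω, (∑ i ∈ s, Y i ω - ∑ i ∈ s, ∫ ω', Y i ω' ∂P) ^ 2 ∂P ≤ ∑ i ∈ s, ∫ ω, Y i ω ^ 2 ∂P := by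
  have h1 := IndepFun.variance_sum (μ := P) (X := Y) (s := s) (fun i _ => (hb i).memLp)
    (fun i _ j _ hij => hind.indepFun hij)
  have h2 : ∫ ω, (∑ i ∈ s, Y i) ω ∂P = ∑ i ∈ s, ∫ ω', Y i ω' ∂P := by
    simp only [Finset.sum_apply]
    exact integral_finsetSum _ fun i _ => (hb i).integrable
  rw [variance_eq_integral, h2] at h1
  · simp only [Finset.sum_apply] at h1
    rw [h1]
    exact Finset.sum_le_sum fun i _ => variance_le_expectation_sq
      (hb i).measurable.aestronglyMeasurable
  · exact (Finset.aemeasurable_sum _ fun i _ => (hb i).measurable.aemeasurable)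

/-- Cauchy–Schwarz in the form `|Y| ≤ (d + Y²/d)/2`. -/
lemma integral_abs_le_of_sq [IsProbabilityMeasure P] {Y : Ω → ℝ} (hY : IsBddRV Y) {d : ℝ}
    (hd : 0 < d) (h : ∫ ω, Y ω ^ 2 ∂P ≤ d ^ 2) : ∫ ω, |Y ω| ∂P ≤ d := by
  have hpt : ∀ ω, |Y ω| ≤ (d + d⁻¹ * Y ω ^ 2) / 2 := by
    intro ω
    have : 0 ≤ d⁻¹ * (|Y ω| - d) ^ 2 := by positivity
    have e : d⁻¹ * (|Y ω| - d) ^ 2 = d⁻¹ * Y ω ^ 2 - 2 * |Y ω| + d := by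
      rw [sub_sq, sq_abs]
      field_simp
    linarith
  have hb : IsBddRV fun ω => (d + d⁻¹ * Y ω ^ 2) / 2 := by
    simpa [div_eq_mul_inv] using ((IsBddRV.const d).add ((IsBddRV.const d⁻¹).mul hY.sq)).mul
      (IsBddRV.const 2⁻¹)
  refine (integral_mono hY.abs.integrable hb.integrable hpt).trans ?_
  rw [integral_div, integral_add (IsBddRV.const d).integrable
    ((IsBddRV.const d⁻¹).mul hY.sq).integrable, integral_const_mul]
  simp only [integral_const, probReal_univ, one_smul]
  have : d⁻¹ * ∫ ω, Y ω ^ 2 ∂P ≤ d⁻¹ * d ^ 2 := by gcongr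
  have e : d⁻¹ * d ^ 2 = d := by field_simp
  linarith

/-! ### The concentration inequality -/

/-- Truncation of `x ↦ x - c` to `[-m, m]`. -/
noncomputable def clamp (c m x : ℝ) : ℝ := max (-m) (min m (x - c))

lemma clamp_mono (c m : ℝ) : Monotone (clamp c m) := fun x y h => by
  unfold clamp
  gcongr

lemma abs_clamp_le (c : ℝ) {m : ℝ} (hm : 0 ≤ m) (x : ℝ) : |clamp c m x| ≤ m := by
  rw [abs_le, clamp]
  exact ⟨le_max_left _ _, max_le (by linarith) (min_le_left _ _)⟩

lemma measurable_clamp (c m : ℝ) : Measurable (clamp c m) := by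
  unfold clamp
  fun_prop

lemma mul_clamp_sub_nonneg (c m w x : ℝ) : 0 ≤ x * (clamp c m w - clamp c m (w - x)) := by
  rcases le_total 0 x with h | h
  · exact mul_nonneg h (sub_nonneg.2 (clamp_mono c m (by linarith)))
  · exact mul_nonneg_of_nonpos_of_nonpos h (sub_nonpos.2 (clamp_mono c m (by linarith)))

/-- On `[a, b]` the truncation is inactive and leaves room `δ` on both sides, so a displacement by
`x` moves the clamp by at least `min δ |x|` in the same direction. -/
lemma abs_mul_min_le_mul_clamp_sub {a b δ w : ℝ} (hδ : 0 ≤ δ) (ha : a ≤ w) (hb : w ≤ b) (x : ℝ) :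
    |x| * min δ |x| ≤ x * (clamp ((a + b) / 2) ((b - a) / 2 + δ) w
      - clamp ((a + b) / 2) ((b - a) / 2 + δ) (w - x)) := by
  have hw : clamp ((a + b) / 2) ((b - a) / 2 + δ) w = w - (a + b) / 2 := by
    rw [clamp, min_eq_right (by linarith), max_eq_right (by linarith)]
  rw [hw]
  rcases le_total 0 x with h | h
  · rw [abs_of_nonneg h]
    refine mul_le_mul_of_nonneg_left ?_ h
    have : clamp ((a + b) / 2) ((b - a) / 2 + δ) (w - x) ≤ max (-((b - a) / 2 + δ))
        (w - x - (a + b) / 2) := max_le_max le_rfl (min_le_right _ _)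
    rcases max_choice (-((b - a) / 2 + δ)) (w - x - (a + b) / 2) with h' | h' <;> rw [h'] at this
    · exact (min_le_left _ _).trans (by linarith)
    · exact (min_le_right _ _).trans (by linarith)
  · rw [abs_of_nonpos h]
    have : min ((b - a) / 2 + δ) (w - x - (a + b) / 2) ≤
      clamp ((a + b) / 2) ((b - a) / 2 + δ) (w - x) := le_max_right _ _
    have h2 : min δ (-x) ≤ clamp ((a + b) / 2) ((b - a) / 2 + δ) (w - x) - (w - (a + b) / 2) := by
      rcases min_choice ((b - a) / 2 + δ) (w - x - (a + b) / 2) with h' | h' <;> rw [h'] at this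
      · exact (min_le_left _ _).trans (by linarith)
      · exact (min_le_right _ _).trans (by linarith)
    nlinarith

section Sums

variable {ξ : ι → Ω → ℝ}

lemma integral_abs_sum_le_one [IsProbabilityMeasure P] {s : Finset ι} (hb : ∀ i, IsBddRV (ξ i)) (hind : iIndepFun ξ P)
    (h0 : ∀ i, ∫ ω, ξ i ω ∂P = 0) (h1 : ∑ i ∈ s, ∫ ω, ξ i ω ^ 2 ∂P ≤ 1) :
    ∫ ω, |∑ i ∈ s, ξ i ω| ∂P ≤ 1 := by
  refine integral_abs_le_of_sq (IsBddRV.sum fun i _ => hb i) one_pos ?_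
  have := integral_sum_sub_sq_le (s := s) hb hind
  simp only [h0, Finset.sum_const_zero, sub_zero] at this
  linarith

lemma indepFun_sum_erase [DecidableEq ι] {s : Finset ι} (hb : ∀ i, IsBddRV (ξ i))
    (hind : iIndepFun ξ P) (i : ι) :
    IndepFun (ξ i) (fun ω => ∑ j ∈ s.erase i, ξ j ω) P := by
  have := hind.indepFun_finsetSum_of_notMem (fun i => (hb i).measurable) (Finset.notMem_erase i s)
  convert this.symm using 1
  ext ω
  simp

/-- Two estimates of `E[V f(V)]`, with `f` the clamp of height `m = (b - a)/2 + δ`. From above it is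
at most `m`, since `E|V| ≤ 1`. From below it is at least `P(A)/2 - δ`: on `A` it dominates `∑ |ξ i|
min(δ, |ξ i|)`, which has mean at least `1/2` and mean deviation at most `δ`. -/
lemma measureReal_mem_Icc_sum_le [IsProbabilityMeasure P] {s : Finset ι} (hb : ∀ i, IsBddRV (ξ i)) (hind : iIndepFun ξ P)
    (h0 : ∀ i, ∫ ω, ξ i ω ∂P = 0) (h1 : ∑ i ∈ s, ∫ ω, ξ i ω ^ 2 ∂P ≤ 1) {δ : ℝ} (hδ : 0 < δ)
    (h2 : 1 / 2 ≤ ∑ i ∈ s, ∫ ω, |ξ i ω| * min δ |ξ i ω| ∂P) {a b : ℝ} (hab : a ≤ b) :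
    P.real {ω | ∑ i ∈ s, ξ i ω ∈ Set.Icc a b} ≤ (b - a) + 4 * δ := by
  classical
  set V : Ω → ℝ := fun ω => ∑ i ∈ s, ξ i ω with hV
  set A : Set Ω := {ω | V ω ∈ Set.Icc a b} with hA
  set m : ℝ := (b - a) / 2 + δ with hm
  set f : ℝ → ℝ := clamp ((a + b) / 2) m with hf
  set η : ι → Ω → ℝ := fun i ω => |ξ i ω| * min δ |ξ i ω| with hη
  have hm0 : 0 ≤ m := by linarith
  have hVb : IsBddRV V := IsBddRV.sum fun i _ => hb i
  have hAm : MeasurableSet A := hVb.measurable measurableSet_Icc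
  have hfb : ∀ {Y : Ω → ℝ}, IsBddRV Y → IsBddRV fun ω => f (Y ω) := fun hY =>
    hY.comp (measurable_clamp _ _) (abs_clamp_le _ hm0)
  have hηb : ∀ i, IsBddRV (η i) := fun i => (hb i).abs.mul ((hb i).abs.min_const δ)
  have hηind : iIndepFun η P :=
    hind.comp (fun _ x => |x| * min δ |x|) (fun _ => by fun_prop)
  have hup : ∫ ω, V ω * f (V ω) ∂P ≤ m := by
    have hle : ∀ ω, V ω * f (V ω) ≤ |V ω| * m := fun ω => by
      refine (le_abs_self _).trans ?_
      rw [abs_mul]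
      exact mul_le_mul_of_nonneg_left (abs_clamp_le _ hm0 _) (abs_nonneg _)
    refine (integral_mono (hVb.mul (hfb hVb)).integrable (hVb.abs.mul (.const m)).integrable
      hle).trans ?_
    rw [integral_mul_const]
    exact mul_le_of_le_one_left hm0 (integral_abs_sum_le_one hb hind h0 h1)
  have hsplit : ∫ ω, V ω * f (V ω) ∂P
      = ∫ ω, ∑ i ∈ s, ξ i ω * (f (V ω) - f (V ω - ξ i ω)) ∂P := by
    -- `V - ξ i` is independent of the centred variable `ξ i`.
    have hzero : ∀ i ∈ s, ∫ ω, ξ i ω * f (V ω - ξ i ω) ∂P = 0 := by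
      intro i hi
      have he : ∀ ω, V ω - ξ i ω = ∑ j ∈ s.erase i, ξ j ω := fun ω => by
        have := Finset.add_sum_erase s (fun j => ξ j ω) hi
        simp only [hV]
        linarith
      simp only [he]
      have := integral_mul_comp_of_indepFun (indepFun_sum_erase (s := s) hb hind i)
        (hb i).measurable (IsBddRV.sum fun i _ => hb i).measurable measurable_id
        (measurable_clamp ((a + b) / 2) m)
      simp only [id, h0, zero_mul] at this
      exact this
    rw [integral_finsetSum _ fun i _ =>
      ((hb i).mul ((hfb hVb).sub (hfb (hVb.sub (hb i))))).integrable]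
    simp only [mul_sub]
    have : ∀ i ∈ s, ∫ ω, (ξ i ω * f (V ω) - ξ i ω * f (V ω - ξ i ω)) ∂P
        = ∫ ω, ξ i ω * f (V ω) ∂P := fun i hi => by
      rw [integral_sub ((hb i).mul (hfb hVb)).integrable
        ((hb i).mul (hfb (hVb.sub (hb i)))).integrable, hzero i hi, sub_zero]
    rw [Finset.sum_congr rfl this, ← integral_finsetSum _ fun i _ =>
      ((hb i).mul (hfb hVb)).integrable]
    simp only [← Finset.sum_mul]
    rfl
  set h : ℝ := ∑ i ∈ s, ∫ ω, η i ω ∂P with hh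
  have hdev : ∫ ω, |∑ i ∈ s, η i ω - h| ∂P ≤ δ := by
    refine integral_abs_le_of_sq ((IsBddRV.sum fun i _ => hηb i).sub (.const h)) hδ ?_
    refine (integral_sum_sub_sq_le hηb hηind).trans ?_
    calc ∑ i ∈ s, ∫ ω, η i ω ^ 2 ∂P ≤ ∑ i ∈ s, ∫ ω, δ ^ 2 * ξ i ω ^ 2 ∂P := by
          refine Finset.sum_le_sum fun i _ => integral_mono (hηb i).sq.integrable
            ((IsBddRV.const _).mul (hb i).sq).integrable fun ω => ?_
          simp only [hη, mul_pow, sq_abs]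
          rw [mul_comm]
          have : min δ |ξ i ω| ^ 2 ≤ δ ^ 2 := by
            have h0 : 0 ≤ min δ |ξ i ω| := le_min hδ.le (abs_nonneg _)
            gcongr
            exact min_le_left _ _
          gcongr
      _ = δ ^ 2 * ∑ i ∈ s, ∫ ω, ξ i ω ^ 2 ∂P := by
          simp only [integral_const_mul, Finset.mul_sum]
      _ ≤ δ ^ 2 := mul_le_of_le_one_right (by positivity) h1
  have hlow : ∀ ω, A.indicator (fun _ => (1 : ℝ)) ω * h - |∑ i ∈ s, η i ω - h|
      ≤ ∑ i ∈ s, ξ i ω * (f (V ω) - f (V ω - ξ i ω)) := by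
    intro ω
    by_cases hω : ω ∈ A
    · rw [Set.indicator_of_mem hω, one_mul]
      have h3 : ∑ i ∈ s, η i ω ≤ ∑ i ∈ s, ξ i ω * (f (V ω) - f (V ω - ξ i ω)) :=
        Finset.sum_le_sum fun i _ => abs_mul_min_le_mul_clamp_sub hδ.le hω.1 hω.2 _
      linarith [neg_abs_le (∑ i ∈ s, η i ω - h)]
    · rw [Set.indicator_of_notMem hω, zero_mul]
      have h3 : 0 ≤ ∑ i ∈ s, ξ i ω * (f (V ω) - f (V ω - ξ i ω)) :=
        Finset.sum_nonneg fun i _ => mul_clamp_sub_nonneg _ _ _ _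
      linarith [abs_nonneg (∑ i ∈ s, η i ω - h)]
  have hI1 : IsBddRV fun ω => A.indicator (fun _ => (1 : ℝ)) ω * h :=
    (IsBddRV.indicator hAm).mul (.const h)
  have hI2 : IsBddRV fun ω => |∑ i ∈ s, η i ω - h| :=
    ((IsBddRV.sum fun i _ => hηb i).sub (.const h)).abs
  have hI3 : IsBddRV fun ω => ∑ i ∈ s, ξ i ω * (f (V ω) - f (V ω - ξ i ω)) :=
    IsBddRV.sum fun i _ => (hb i).mul ((hfb hVb).sub (hfb (hVb.sub (hb i))))
  have hfin := integral_mono (μ := P) (hI1.sub hI2).integrable hI3.integrable hlow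
  rw [← hsplit, integral_sub hI1.integrable hI2.integrable, integral_mul_const,
    integral_indicator_const _ hAm, smul_eq_mul, mul_one] at hfin
  have hh2 : 1 / 2 ≤ h := h2
  have : P.real A * (1 / 2) ≤ P.real A * h := mul_le_mul_of_nonneg_left hh2 measureReal_nonneg
  linarith

end Sums

end SteinMethod

namespace SteinMethod

variable {Ω ι : Type*} [MeasurableSpace Ω] {P : Measure Ω}

/-! ### The Berry–Esseen inequality -/

section BerryEsseen

lemma integral_sq_le_one [Fintype ι] {ξ : ι → Ω → ℝ}
    (h1 : ∑ i, ∫ ω, ξ i ω ^ 2 ∂P = 1) (i : ι) :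
    ∫ ω, ξ i ω ^ 2 ∂P ≤ 1 := by
  rw [← h1]
  exact Finset.single_le_sum (f := fun i => ∫ ω, ξ i ω ^ 2 ∂P)
    (fun i _ => integral_nonneg fun ω => sq_nonneg _) (Finset.mem_univ i)

variable [IsProbabilityMeasure P] {ξ : ι → Ω → ℝ}

/-- Chebyshev's association inequality: `x²` and `min(1, |x|)` both increase with `|x|`. Centring at
`s = √(E X²)` makes the extra term vanish in expectation. -/
lemma integral_sq_mul_integral_le {X : Ω → ℝ} (hX : IsBddRV X) :
    (∫ ω, X ω ^ 2 ∂P) * ∫ ω, min 1 |X ω| ∂P ≤ ∫ ω, X ω ^ 2 * min 1 |X ω| ∂P := by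
  set s : ℝ := √(∫ ω, X ω ^ 2 ∂P) with hs
  have hs2 : s ^ 2 = ∫ ω, X ω ^ 2 ∂P := Real.sq_sqrt (integral_nonneg fun ω => sq_nonneg _)
  have hs0 : 0 ≤ s := Real.sqrt_nonneg _
  have hpt : ∀ ω, 0 ≤ (X ω ^ 2 - s ^ 2) * (min 1 |X ω| - min 1 s) := by
    intro ω
    rw [← sq_abs]
    rcases le_total |X ω| s with h | h
    · exact mul_nonneg_of_nonpos_of_nonpos
        (sub_nonpos.2 (pow_le_pow_left₀ (abs_nonneg _) h 2))
        (sub_nonpos.2 (min_le_min_left 1 h))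
    · exact mul_nonneg (sub_nonneg.2 (pow_le_pow_left₀ hs0 h 2))
        (sub_nonneg.2 (min_le_min_left 1 h))
  have hm : IsBddRV fun ω => min 1 |X ω| := hX.abs.min_const 1
  have h1 : IsBddRV fun ω => X ω ^ 2 * min 1 |X ω| := hX.sq.mul hm
  have h2 : IsBddRV fun ω => s ^ 2 * min 1 |X ω| := (IsBddRV.const _).mul hm
  have h3 : IsBddRV fun ω => X ω ^ 2 * min 1 s - s ^ 2 * min 1 s :=
    (hX.sq.mul (.const _)).sub (.const _)
  have hint := integral_nonneg (μ := P)
    (f := fun ω => (X ω ^ 2 - s ^ 2) * (min 1 |X ω| - min 1 s)) hpt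
  have e : ∀ ω, (X ω ^ 2 - s ^ 2) * (min 1 |X ω| - min 1 s)
      = X ω ^ 2 * min 1 |X ω| - s ^ 2 * min 1 |X ω| - (X ω ^ 2 * min 1 s - s ^ 2 * min 1 s) :=
    fun ω => by ring
  simp only [e] at hint
  rw [integral_sub (h1.sub h2).integrable h3.integrable, integral_sub h1.integrable h2.integrable,
    integral_sub (hX.sq.mul (.const _)).integrable (IsBddRV.const _).integrable,
    integral_mul_const, integral_const_mul] at hint
  simp only [integral_const, probReal_univ, one_smul, ← hs2] at hint
  rw [← hs2]
  linarith

variable [Fintype ι]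

/-- Concentration at scale `δ = 2β`. The truncated sum over all indices is at least `1 - β/(8β) =
7/8`, and the omitted index contributes at most `2β ≤ 1/4`, so more than the required `1/2` remains.
-/
lemma measureReal_leave_one_out_le [DecidableEq ι] (hb : ∀ i, IsBddRV (ξ i))
    (hind : iIndepFun ξ P) (h0 : ∀ i, ∫ ω, ξ i ω ∂P = 0) (h1 : ∑ i, ∫ ω, ξ i ω ^ 2 ∂P = 1)
    {β : ℝ} (hβ0 : 0 < β) (hβ : β ≤ 1 / 8)
    (hsum : ∑ i, ∫ ω, ξ i ω ^ 2 * min 1 |ξ i ω| ∂P ≤ β) (i : ι) {a b : ℝ} (hab : a ≤ b) :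
    P.real {ω | ∑ j ∈ Finset.univ.erase i, ξ j ω ∈ Set.Icc a b} ≤ (b - a) + 8 * β := by
  have hηb : ∀ j, IsBddRV fun ω => |ξ j ω| * min (2 * β) |ξ j ω| := fun j =>
    (hb j).abs.mul ((hb j).abs.min_const _)
  have hpt : ∀ x : ℝ, x ^ 2 - (8 * β)⁻¹ * (x ^ 2 * min 1 |x|) ≤ |x| * min (2 * β) |x| := by
    intro x
    rw [← sq_abs]
    set y := |x| with hy
    have hy0 : 0 ≤ y := abs_nonneg x
    have h8 : (8 * β) * (8 * β)⁻¹ = 1 := mul_inv_cancel₀ (by positivity)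
    have h8' : 1 ≤ (8 * β)⁻¹ := (one_le_inv₀ (by positivity)).2 (by linarith)
    rcases le_total y 1 with h | h
    · rw [min_eq_right h]
      have : y - (8 * β)⁻¹ * y ^ 2 ≤ min (2 * β) y := by
        refine le_min ?_ (by nlinarith [sq_nonneg y])
        -- Completing the square: the maximum of `y - y²/(8β)` is `2β`, attained at `y = 4β`.
        have : 0 ≤ (8 * β)⁻¹ * (y - 4 * β) ^ 2 := by positivity
        have e : (8 * β)⁻¹ * (y - 4 * β) ^ 2
          = (8 * β)⁻¹ * y ^ 2 - y * (8 * β * (8 * β)⁻¹) + 2 * β * (8 * β * (8 * β)⁻¹) := by ring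
        rw [h8] at e
        linarith
      nlinarith
    · rw [min_eq_left h]
      have h3 : 0 ≤ y * min (2 * β) y := mul_nonneg hy0 (le_min (by positivity) hy0)
      nlinarith [sq_nonneg y]
  have hall : 7 / 8 ≤ ∑ j, ∫ ω, |ξ j ω| * min (2 * β) |ξ j ω| ∂P := by
    have hle : ∀ j ∈ Finset.univ, ∫ ω, ξ j ω ^ 2 ∂P
        - (8 * β)⁻¹ * ∫ ω, ξ j ω ^ 2 * min 1 |ξ j ω| ∂P
        ≤ ∫ ω, |ξ j ω| * min (2 * β) |ξ j ω| ∂P := by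
      intro j _
      have hB : IsBddRV fun ω => ξ j ω ^ 2 * min 1 |ξ j ω| :=
        (hb j).sq.mul ((hb j).abs.min_const 1)
      rw [← integral_const_mul, ← integral_sub (hb j).sq.integrable
        ((IsBddRV.const _).mul hB).integrable]
      exact integral_mono ((hb j).sq.sub ((IsBddRV.const _).mul hB)).integrable
        (hηb j).integrable fun ω => hpt _
    have := Finset.sum_le_sum hle
    rw [Finset.sum_sub_distrib, h1, ← Finset.mul_sum] at this
    have h2 := mul_le_mul_of_nonneg_left hsum (by positivity : 0 ≤ (8 * β)⁻¹)
    have h3 : (8 * β)⁻¹ * β = 1 / 8 := by field_simp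
    linarith
  have hone : ∫ ω, |ξ i ω| * min (2 * β) |ξ i ω| ∂P ≤ 2 * β := by
    have h2 : ∫ ω, |ξ i ω| ∂P ≤ 1 :=
      integral_abs_le_of_sq (hb i) one_pos (by simpa using integral_sq_le_one h1 i)
    refine (integral_mono (hηb i).integrable ((hb i).abs.mul (.const (2 * β))).integrable
      fun ω => mul_le_mul_of_nonneg_left (min_le_left _ _) (abs_nonneg _)).trans ?_
    rw [integral_mul_const]
    exact mul_le_of_le_one_left (by positivity) h2
  have herase := Finset.add_sum_erase Finset.univ
    (fun j => ∫ ω, |ξ j ω| * min (2 * β) |ξ j ω| ∂P) (Finset.mem_univ i)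
  have hsq : ∑ j ∈ Finset.univ.erase i, ∫ ω, ξ j ω ^ 2 ∂P ≤ 1 := by
    rw [← h1]
    exact Finset.sum_le_sum_of_subset_of_nonneg (Finset.erase_subset _ _)
      fun j _ _ => integral_nonneg fun ω => sq_nonneg _
  have := measureReal_mem_Icc_sum_le hb hind h0 hsq (by positivity : 0 < 2 * β)
    (by linarith) hab
  linarith

lemma integral_steinModulus_le [DecidableEq ι] (hb : ∀ i, IsBddRV (ξ i))
    (hind : iIndepFun ξ P) (h0 : ∀ i, ∫ ω, ξ i ω ∂P = 0) (h1 : ∑ i, ∫ ω, ξ i ω ^ 2 ∂P = 1)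
    {β : ℝ} (hβ0 : 0 < β) (hβ : β ≤ 1 / 8)
    (hsum : ∑ i, ∫ ω, ξ i ω ^ 2 * min 1 |ξ i ω| ∂P ≤ β) (i : ι) (z u : ℝ) :
    ∫ ω, steinModulus z (∑ j ∈ Finset.univ.erase i, ξ j ω) u ∂P ≤ 16 * min 1 |u| + 32 * β := by
  set V : Ω → ℝ := fun ω => ∑ j ∈ Finset.univ.erase i, ξ j ω with hV
  have hVb : IsBddRV V := IsBddRV.sum fun j _ => hb j
  have hQ : IsBddRV fun ω => steinModulus z (V ω) u :=
    ⟨(measurable_steinModulus z).comp (hVb.measurable.prodMk measurable_const), 4, fun ω => by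
      rw [abs_of_nonneg (steinModulus_nonneg _ _ _)]
      exact steinModulus_le_four _ _ _⟩
  have h4 : ∫ ω, steinModulus z (V ω) u ∂P ≤ 4 := by
    have := integral_mono (μ := P) hQ.integrable (IsBddRV.const 4).integrable
      fun ω => steinModulus_le_four z (V ω) u
    simpa using this
  rcases le_total 1 |u| with hu | hu
  · rw [min_eq_left hu]
    linarith
  rw [min_eq_right hu]
  set A : Set Ω := {ω | V ω ∈ Set.Icc (z - |u|) (z + |u|)} with hA
  have hAm : MeasurableSet A := hVb.measurable measurableSet_Icc
  have hPA : P.real A ≤ (z + |u| - (z - |u|)) + 8 * β :=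
    measureReal_leave_one_out_le hb hind h0 h1 hβ0 hβ hsum i (by linarith [abs_nonneg u])
  have hpt : ∀ ω, steinModulus z (V ω) u
      ≤ 4 * (|u| * (|V ω| + 1) + A.indicator (fun _ => (1 : ℝ)) ω) := by
    intro ω
    have e : A.indicator (fun _ => (1 : ℝ)) ω = if |V ω - z| ≤ |u| then 1 else 0 := by
      rw [Set.indicator_apply]
      refine if_congr ?_ rfl rfl
      rw [hA, Set.mem_ofPred_eq, Set.mem_Icc, abs_le]
      constructor <;> rintro ⟨h, h'⟩ <;> constructor <;> linarith
    rw [e, steinModulus]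
    linarith [min_le_right 1 (|u| * (|V ω| + 1) + if |V ω - z| ≤ |u| then 1 else 0)]
  have hB1 : IsBddRV fun ω => |u| * (|V ω| + 1) :=
    (IsBddRV.const _).mul (hVb.abs.add (.const 1))
  have hB2 : IsBddRV (A.indicator fun _ => (1 : ℝ)) := IsBddRV.indicator hAm
  have hV1 : ∫ ω, |V ω| ∂P ≤ 1 := by
    refine integral_abs_sum_le_one hb hind h0 ?_
    rw [← h1]
    exact Finset.sum_le_sum_of_subset_of_nonneg (Finset.erase_subset _ _)
      fun j _ _ => integral_nonneg fun ω => sq_nonneg _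
  have := integral_mono (μ := P) hQ.integrable
    -- With `E|V| ≤ 1` and an interval of length `2|u|`, the total is `4(2|u| + 2|u| + 8β)`.
    ((IsBddRV.const 4).mul (hB1.add hB2)).integrable hpt
  rw [integral_const_mul, integral_add hB1.integrable hB2.integrable, integral_const_mul,
    integral_add hVb.abs.integrable (IsBddRV.const 1).integrable,
    integral_indicator_const _ hAm, smul_eq_mul, mul_one] at this
  simp only [integral_const, probReal_univ, one_smul] at this
  have h5 := mul_le_mul_of_nonneg_left hV1 (abs_nonneg u)
  linarith

/-- Expand `f(V + ξ)` about `V`. The zeroth-order term vanishes and the first-order term is `E ξ² ·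
E f'(V)`, by independence. What remains is a Taylor remainder and the replacement of `f'(V)` by
`f'(W)`; each is at most `16 E[ξ² min(1, |ξ|)] + 32β E ξ²`, the latter via the association
inequality. -/
lemma abs_stein_summand_le [DecidableEq ι] (hb : ∀ i, IsBddRV (ξ i))
    (hind : iIndepFun ξ P) (h0 : ∀ i, ∫ ω, ξ i ω ∂P = 0) (h1 : ∑ i, ∫ ω, ξ i ω ^ 2 ∂P = 1)
    {β : ℝ} (hβ0 : 0 < β) (hβ : β ≤ 1 / 8)
    (hsum : ∑ i, ∫ ω, ξ i ω ^ 2 * min 1 |ξ i ω| ∂P ≤ β) (i : ι) (z : ℝ) :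
    |(∫ ω, ξ i ω ^ 2 ∂P) * ∫ ω, steinDeriv z (∑ j, ξ j ω) ∂P
        - ∫ ω, ξ i ω * steinSol z (∑ j, ξ j ω) ∂P|
      ≤ 32 * ∫ ω, ξ i ω ^ 2 * min 1 |ξ i ω| ∂P + 64 * β * ∫ ω, ξ i ω ^ 2 ∂P := by
  set V : Ω → ℝ := fun ω => ∑ j ∈ Finset.univ.erase i, ξ j ω with hV
  have hW : ∀ ω, ∑ j, ξ j ω = V ω + ξ i ω := fun ω => by
    have := Finset.add_sum_erase Finset.univ (fun j => ξ j ω) (Finset.mem_univ i)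
    simp only [hV]
    linarith
  simp only [hW]
  have hVb : IsBddRV V := IsBddRV.sum fun j _ => hb j
  have hVi : IndepFun (ξ i) V P := indepFun_sum_erase hb hind i
  have hWb : IsBddRV fun ω => V ω + ξ i ω := hVb.add (hb i)
  have hQ : IsBddRV fun ω => steinModulus z (V ω) (ξ i ω) :=
    ⟨(measurable_steinModulus z).comp (hVb.measurable.prodMk (hb i).measurable), 4, fun ω => by
      rw [abs_of_nonneg (steinModulus_nonneg _ _ _)]
      exact steinModulus_le_four _ _ _⟩
  have hf : ∀ {Y : Ω → ℝ}, IsBddRV Y → IsBddRV fun ω => steinSol z (Y ω) := fun hY =>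
    hY.comp (continuous_steinSol z).measurable (abs_steinSol_le z)
  have hg : ∀ {Y : Ω → ℝ}, IsBddRV Y → IsBddRV fun ω => steinDeriv z (Y ω) := fun hY =>
    hY.comp (measurable_steinDeriv z) (abs_steinDeriv_le z)
  have hmin : IsBddRV fun ω => min 1 |ξ i ω| := (hb i).abs.min_const 1
  have hsqmin : IsBddRV fun ω => ξ i ω ^ 2 * min 1 |ξ i ω| := (hb i).sq.mul hmin
  have hHb : IsBddRV fun ω => 16 * min 1 |ξ i ω| + 32 * β :=
    ((IsBddRV.const 16).mul hmin).add (.const _)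
  have hH : Measurable fun x : ℝ => 16 * min 1 |x| + 32 * β := by fun_prop
  have hQabs : ∀ q : ℝ × ℝ, |steinModulus z q.1 q.2| ≤ 4 := fun q => by
    rw [abs_of_nonneg (steinModulus_nonneg _ _ _)]
    exact steinModulus_le_four _ _ _
  have hEQ : ∫ ω, steinModulus z (V ω) (ξ i ω) ∂P ≤ 16 * ∫ ω, min 1 |ξ i ω| ∂P + 32 * β := by
    have := integral_le_of_indepFun (φ := fun _ => 1) (G := fun q => steinModulus z q.1 q.2)
      (H := fun x => 16 * min 1 |x| + 32 * β) hVi (hb i) hVb measurable_const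
      (fun _ => zero_le_one) (.const 1) (measurable_steinModulus z) hQabs hH hHb
      (fun u => integral_steinModulus_le hb hind h0 h1 hβ0 hβ hsum i z u)
    simp only [one_mul] at this
    rw [integral_add ((IsBddRV.const 16).mul hmin).integrable (IsBddRV.const _).integrable,
      integral_const_mul] at this
    simpa using this
  have hEsqQ : ∫ ω, ξ i ω ^ 2 * steinModulus z (V ω) (ξ i ω) ∂P
      ≤ 16 * ∫ ω, ξ i ω ^ 2 * min 1 |ξ i ω| ∂P + 32 * β * ∫ ω, ξ i ω ^ 2 ∂P := by
    have := integral_le_of_indepFun (φ := fun x => x ^ 2) (G := fun q => steinModulus z q.1 q.2)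
      (H := fun x => 16 * min 1 |x| + 32 * β) hVi (hb i) hVb (by fun_prop)
      (fun _ => sq_nonneg _) (hb i).sq (measurable_steinModulus z) hQabs hH hHb
      (fun u => integral_steinModulus_le hb hind h0 h1 hβ0 hβ hsum i z u)
    refine this.trans_eq ?_
    have e : ∀ ω, ξ i ω ^ 2 * (16 * min 1 |ξ i ω| + 32 * β)
        = 16 * (ξ i ω ^ 2 * min 1 |ξ i ω|) + 32 * β * ξ i ω ^ 2 := fun ω => by ring
    simp only [e]
    rw [integral_add ((IsBddRV.const 16).mul hsqmin).integrable
      ((IsBddRV.const _).mul (hb i).sq).integrable, integral_const_mul, integral_const_mul]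
  have hassoc := integral_sq_mul_integral_le (P := P) (hb i)
  have hs0 : 0 ≤ ∫ ω, ξ i ω ^ 2 ∂P := integral_nonneg fun ω => sq_nonneg _
  have hderiv : |∫ ω, steinDeriv z (V ω + ξ i ω) ∂P - ∫ ω, steinDeriv z (V ω) ∂P|
      ≤ ∫ ω, steinModulus z (V ω) (ξ i ω) ∂P := by
    rw [← integral_sub (hg hWb).integrable (hg hVb).integrable]
    refine abs_integral_le_integral_abs.trans (integral_mono ((hg hWb).sub (hg hVb)).abs.integrable
      hQ.integrable fun ω => abs_steinDeriv_sub_le _ _ _)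
  have hT : IsBddRV fun ω => ξ i ω * (steinSol z (V ω + ξ i ω) - steinSol z (V ω)
      - ξ i ω * steinDeriv z (V ω)) :=
    (hb i).mul (((hf hWb).sub (hf hVb)).sub ((hb i).mul (hg hVb)))
  have htaylor : |∫ ω, ξ i ω * (steinSol z (V ω + ξ i ω) - steinSol z (V ω)
      - ξ i ω * steinDeriv z (V ω)) ∂P| ≤ ∫ ω, ξ i ω ^ 2 * steinModulus z (V ω) (ξ i ω) ∂P := by
    refine abs_integral_le_integral_abs.trans (integral_mono hT.abs.integrable
      ((hb i).sq.mul hQ).integrable fun ω => ?_)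
    simp only
    rw [abs_mul, ← sq_abs (ξ i ω), pow_two, mul_assoc]
    exact mul_le_mul_of_nonneg_left (abs_steinSol_taylor_le _ _ _) (abs_nonneg _)
  have hprod0 : ∫ ω, ξ i ω * steinSol z (V ω) ∂P = 0 := by
    have := integral_mul_comp_of_indepFun hVi (hb i).measurable hVb.measurable measurable_id
      (continuous_steinSol z).measurable
    simp only [id, h0, zero_mul] at this
    exact this
  have hprod2 : ∫ ω, ξ i ω ^ 2 * steinDeriv z (V ω) ∂P
      = (∫ ω, ξ i ω ^ 2 ∂P) * ∫ ω, steinDeriv z (V ω) ∂P :=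
    integral_mul_comp_of_indepFun hVi (hb i).measurable hVb.measurable (φ := fun x => x ^ 2)
      (by fun_prop) (measurable_steinDeriv z)
  have hdecomp : ∫ ω, ξ i ω * steinSol z (V ω + ξ i ω) ∂P
      = ∫ ω, ξ i ω * (steinSol z (V ω + ξ i ω) - steinSol z (V ω)
          - ξ i ω * steinDeriv z (V ω)) ∂P
        + (∫ ω, ξ i ω ^ 2 ∂P) * ∫ ω, steinDeriv z (V ω) ∂P := by
    have e : ∀ ω, ξ i ω * steinSol z (V ω + ξ i ω)
        = ξ i ω * (steinSol z (V ω + ξ i ω) - steinSol z (V ω) - ξ i ω * steinDeriv z (V ω))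
          + (ξ i ω * steinSol z (V ω) + ξ i ω ^ 2 * steinDeriv z (V ω)) := fun ω => by ring
    rw [integral_congr_ae (Eventually.of_forall e), integral_add hT.integrable
      (((hb i).mul (hf hVb)).add ((hb i).sq.mul (hg hVb))).integrable,
      integral_add ((hb i).mul (hf hVb)).integrable ((hb i).sq.mul (hg hVb)).integrable,
      hprod0, hprod2, zero_add]
  rw [hdecomp]
  set s2 := ∫ ω, ξ i ω ^ 2 ∂P
  set EW := ∫ ω, steinDeriv z (V ω + ξ i ω) ∂P
  set EV := ∫ ω, steinDeriv z (V ω) ∂P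
  set T := ∫ ω, ξ i ω * (steinSol z (V ω + ξ i ω) - steinSol z (V ω)
      - ξ i ω * steinDeriv z (V ω)) ∂P
  have h6 : s2 * EW - (T + s2 * EV) = s2 * (EW - EV) - T := by ring
  rw [h6]
  refine (abs_sub _ _).trans ?_
  rw [abs_mul, abs_of_nonneg hs0]
  have h7 := mul_le_mul_of_nonneg_left (hderiv.trans hEQ) hs0
  linarith

/-- A **Berry–Esseen inequality** for sums of independent bounded random variables, with the
truncated third moments `E (ξ² min(1, |ξ|))`. -/
theorem berry_esseen (hb : ∀ i, IsBddRV (ξ i)) (hind : iIndepFun ξ P)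
    (h0 : ∀ i, ∫ ω, ξ i ω ∂P = 0) (h1 : ∑ i, ∫ ω, ξ i ω ^ 2 ∂P = 1) {β : ℝ} (hβ0 : 0 < β)
    (hsum : ∑ i, ∫ ω, ξ i ω ^ 2 * min 1 |ξ i ω| ∂P ≤ β) (z : ℝ) :
    |P.real {ω | ∑ i, ξ i ω ≤ z} - normalCDF z| ≤ 96 * β := by
  classical
  -- For `β ≥ 1/8` the right-hand side exceeds 1. Otherwise summing the bounds, with `∑ E ξ² = 1`,
  -- gives `32β + 64β`.
  rcases le_total (1 / 8) β with hβ | hβ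
  · have h2 := normalCDF_nonneg z
    have h3 := normalCDF_le_one z
    have h4 : 0 ≤ P.real {ω | ∑ i, ξ i ω ≤ z} := measureReal_nonneg
    have h5 : P.real {ω | ∑ i, ξ i ω ≤ z} ≤ 1 := measureReal_le_one
    rw [abs_le]
    constructor <;> linarith
  set W : Ω → ℝ := fun ω => ∑ i, ξ i ω with hW
  have hWb : IsBddRV W := IsBddRV.sum fun i _ => hb i
  have hfW : IsBddRV fun ω => steinSol z (W ω) :=
    hWb.comp (continuous_steinSol z).measurable (abs_steinSol_le z)
  set A : Set Ω := {ω | W ω ≤ z} with hA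
  have hAm : MeasurableSet A := hWb.measurable measurableSet_Iic
  have hstein : P.real A - normalCDF z
      = ∑ i, ((∫ ω, ξ i ω ^ 2 ∂P) * ∫ ω, steinDeriv z (∑ j, ξ j ω) ∂P
        - ∫ ω, ξ i ω * steinSol z (∑ j, ξ j ω) ∂P) := by
    rw [Finset.sum_sub_distrib, ← Finset.sum_mul, h1, one_mul,
      ← integral_finsetSum _ fun i _ => ((hb i).mul hfW).integrable]
    simp only [← Finset.sum_mul]
    have e : ∀ ω, steinDeriv z (∑ j, ξ j ω) = (∑ j, ξ j ω) * steinSol z (∑ j, ξ j ω)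
        + A.indicator (fun _ => (1 : ℝ)) ω - normalCDF z := by
      intro ω
      rw [steinDeriv, Set.indicator_apply]
      rfl
    rw [integral_congr_ae (Eventually.of_forall e), integral_sub
      ((hWb.mul hfW).add (.indicator hAm)).integrable (IsBddRV.const _).integrable,
      integral_add (hWb.mul hfW).integrable (IsBddRV.indicator hAm).integrable,
      integral_indicator_const _ hAm]
    have hI : ∫ ω, W ω * steinSol z (W ω) ∂P = ∫ ω, (∑ i, ξ i ω) * steinSol z (W ω) ∂P := rfl
    simp only [integral_const, probReal_univ, smul_eq_mul, mul_one]
    rw [hI]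
    ring
  rw [hstein]
  refine (Finset.abs_sum_le_sum_abs _ _).trans ?_
  refine (Finset.sum_le_sum fun i _ =>
    abs_stein_summand_le hb hind h0 h1 hβ0 hβ hsum i z).trans ?_
  rw [Finset.sum_add_distrib, ← Finset.mul_sum, ← Finset.mul_sum, h1]
  linarith

end BerryEsseen

end SteinMethod

/-! ### Linearization of the plug-in estimator and control of its remainder -/

namespace PlugInEntropy

open SteinMethod

variable {Ω : Type*} [MeasurableSpace Ω] {P : Measure Ω}

/-- If `Y` lies between `W - R` and `W` with `E R ≤ ε²`, then the Kolmogorov distance of `Y` to the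
normal law exceeds that of `W` by at most `2 ε`. -/
lemma abs_measureReal_sub_normalCDF_le [IsProbabilityMeasure P] {Y W R : Ω → ℝ} {B ε : ℝ}
    (hR : IsBddRV R) (hR0 : ∀ ω, 0 ≤ R ω) (hε : 0 < ε) (hRε : ∫ ω, R ω ∂P ≤ ε ^ 2)
    (hY : ∀ᵐ ω ∂P, W ω - R ω ≤ Y ω ∧ Y ω ≤ W ω)
    (hW : ∀ z, |P.real {ω | W ω ≤ z} - normalCDF z| ≤ B) (x : ℝ) :
    |P.real {ω | Y ω ≤ x} - normalCDF x| ≤ B + 2 * ε := by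
  -- Since `Y ≤ W`, this side is free; only the upper side needs a shift by `ε` and Markov's
  -- inequality.
  have hlow : P.real {ω | W ω ≤ x} ≤ P.real {ω | Y ω ≤ x} := by
    refine ENNReal.toReal_mono (measure_ne_top _ _) (measure_mono_ae ?_)
    filter_upwards [hY] with ω h h' using h.2.trans h'
  have hup : P.real {ω | Y ω ≤ x} ≤ P.real {ω | W ω ≤ x + ε} + P.real {ω | ε ≤ R ω} := by
    refine le_trans ?_ (measureReal_union_le _ _)
    refine ENNReal.toReal_mono (measure_ne_top _ _) (measure_mono_ae ?_)
    filter_upwards [hY] with ω h h'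
    have h2 : Y ω ≤ x := h'
    rcases le_total ε (R ω) with h3 | h3
    · exact Or.inr h3
    · exact Or.inl (show W ω ≤ x + ε by linarith [h.1])
  have hmarkov : P.real {ω | ε ≤ R ω} ≤ ε := by
    have := mul_meas_ge_le_integral_of_nonneg (Eventually.of_forall hR0) (hR.integrable (P := P)) ε
    have h2 : ε * P.real {ω | ε ≤ R ω} ≤ ε * ε := by
      rw [← pow_two]
      exact this.trans hRε
    exact le_of_mul_le_mul_left h2 hε
  have h1 := abs_le.1 (hW x)
  have h2 := abs_le.1 (hW (x + ε))
  have h3 := normalCDF_add_le x hε.le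
  rw [abs_le]
  constructor <;> linarith

/-! ### The relative entropy of the empirical distribution -/

/-- `log t ≤ t - 1` at `t = p/q`; the next lemma uses it at `t = q/p`. The linear terms `q - p`
cancel on summation, as both total masses agree. -/
lemma sub_le_mul_log_sub {q p : ℝ} (hq : 0 ≤ q) (hp : 0 ≤ p) (h : p = 0 → q = 0) :
    q - p ≤ q * Real.log q - q * Real.log p := by
  rcases hq.eq_or_lt with rfl | hq
  · simpa using hp
  have hp' : 0 < p := hp.lt_of_ne' fun e => hq.ne' (h e)
  have := Real.log_le_sub_one_of_pos (div_pos hp' hq)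
  rw [Real.log_div hp'.ne' hq.ne'] at this
  have h2 := mul_le_mul_of_nonneg_left this hq.le
  have h3 : q * (p / q - 1) = p - q := by field_simp
  linarith

lemma mul_log_sub_le {q p : ℝ} (hq : 0 ≤ q) (hp : 0 ≤ p) (h : p = 0 → q = 0) :
    q * Real.log q - q * Real.log p ≤ (q - p) ^ 2 / p + (q - p) := by
  rcases hp.eq_or_lt with rfl | hp
  · simp [h rfl]
  have e : (q - p) ^ 2 / p + (q - p) = q * (q / p - 1) := by
    field_simp
    ring
  rw [e, ← mul_sub]
  rcases hq.eq_or_lt with rfl | hq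
  · simp
  have := Real.log_le_sub_one_of_pos (div_pos hq hp)
  rw [Real.log_div hq.ne' hp.ne'] at this
  exact mul_le_mul_of_nonneg_left this hq.le

/-- The relative entropy `∑ q(i) ln (q(i) / p(i))` on `{1, …, K}`. -/
noncomputable def relEntropy (K : ℕ) (q p : ℕ → ℝ) : ℝ :=
  ∑ i ∈ Finset.Icc 1 K, (q i * Real.log (q i) - q i * Real.log (p i))

/-- The `χ²`-distance `∑ (q(i) - p(i))² / p(i)` on `{1, …, K}`. -/
noncomputable def chiSq (K : ℕ) (q p : ℕ → ℝ) : ℝ :=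
  ∑ i ∈ Finset.Icc 1 K, (q i - p i) ^ 2 / p i

section RelEntropy

variable {K : ℕ} {p q : ℕ → ℝ}

lemma relEntropy_nonneg (hq : ∀ i ∈ Finset.Icc 1 K, 0 ≤ q i) (hp : ∀ i ∈ Finset.Icc 1 K, 0 ≤ p i)
    (h : ∀ i ∈ Finset.Icc 1 K, p i = 0 → q i = 0)
    (hs : ∑ i ∈ Finset.Icc 1 K, q i = ∑ i ∈ Finset.Icc 1 K, p i) : 0 ≤ relEntropy K q p := by
  have := Finset.sum_le_sum fun i hi => sub_le_mul_log_sub (hq i hi) (hp i hi) (h i hi)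
  rw [Finset.sum_sub_distrib, hs, sub_self] at this
  exact this

lemma relEntropy_le_chiSq (hq : ∀ i ∈ Finset.Icc 1 K, 0 ≤ q i)
    (hp : ∀ i ∈ Finset.Icc 1 K, 0 ≤ p i) (h : ∀ i ∈ Finset.Icc 1 K, p i = 0 → q i = 0)
    (hs : ∑ i ∈ Finset.Icc 1 K, q i = ∑ i ∈ Finset.Icc 1 K, p i) :
    relEntropy K q p ≤ chiSq K q p := by
  have := Finset.sum_le_sum fun i hi => mul_log_sub_le (hq i hi) (hp i hi) (h i hi)
  rw [Finset.sum_add_distrib, Finset.sum_sub_distrib (f := q), hs, sub_self, add_zero] at this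
  exact this

end RelEntropy

/-- Holds at every `ω`: the logarithms in the relative entropy are kept separate, so the identity is
pure algebra even where `p i = 0`. -/
lemma plugIn_sub_entropy {Ω : Type*} {n K : ℕ} {p : ℕ → ℝ} {X : ℕ → Ω → ℕ} (hn : 1 ≤ n) (ω : Ω) :
    plugIn n K X ω - entropy K p
      = -(1 / (n : ℝ) * ∑ j ∈ Finset.Icc 1 n, centeredLog K p (X j) ω)
        - relEntropy K (fun i => empirical n X i ω) p := by
  have hn' : (n : ℝ) ≠ 0 := by positivity
  have h1 : 1 / (n : ℝ) * ∑ j ∈ Finset.Icc 1 n, centeredLog K p (X j) ω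
      = ∑ i ∈ Finset.Icc 1 K, (empirical n X i ω - p i) * Real.log (p i) := by
    simp only [centeredLog]
    rw [Finset.sum_comm, Finset.mul_sum]
    refine Finset.sum_congr rfl fun i _ => ?_
    rw [← Finset.sum_mul, Finset.sum_sub_distrib, empirical]
    simp only [Finset.sum_const, Nat.card_Icc, add_tsub_cancel_right, nsmul_eq_mul]
    field_simp
  rw [h1, plugIn, entropy, entropy, relEntropy]
  simp only [sub_mul, Finset.sum_sub_distrib]
  ring

/-! ### The empirical distribution -/

section Empirical

variable {Ω : Type*} {n K : ℕ} {p : ℕ → ℝ} {X : ℕ → Ω → ℕ}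

lemma empirical_nonneg (i : ℕ) (ω : Ω) : 0 ≤ empirical n X i ω := by
  refine mul_nonneg (by positivity) (Finset.sum_nonneg fun j _ => ?_)
  rw [ind]
  split_ifs <;> norm_num

lemma empirical_eq_zero {ω : Ω} (hω : ∀ k ∈ Finset.Icc 1 n, p (X k ω) ≠ 0) {i : ℕ}
    (hi : p i = 0) : empirical n X i ω = 0 := by
  rw [empirical, Finset.sum_eq_zero, mul_zero]
  intro j hj
  exact if_neg fun (e : X j ω = i) => hω j hj (e ▸ hi)

lemma sum_empirical (hn : 1 ≤ n) {ω : Ω} (hω : ∀ k ∈ Finset.Icc 1 n, X k ω ∈ Finset.Icc 1 K) :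
    ∑ i ∈ Finset.Icc 1 K, empirical n X i ω = 1 := by
  have hn' : (n : ℝ) ≠ 0 := by positivity
  simp only [empirical]
  rw [← Finset.mul_sum, Finset.sum_comm]
  have : ∀ j ∈ Finset.Icc 1 n, ∑ i ∈ Finset.Icc 1 K, ind (X j) i ω = 1 := fun j hj => by
    simp [ind, Finset.mem_Icc.1 (hω j hj)]
  rw [Finset.sum_congr rfl this]
  simp [hn']

end Empirical

/-! ### Samples -/

section Sample

variable {n K : ℕ} {p : ℕ → ℝ} {X : ℕ → Ω → ℕ}

lemma isBddRV_ind {Z : Ω → ℕ} (hZ : Measurable Z) (i : ℕ) : IsBddRV (ind Z i) := by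
  refine ⟨Measurable.ite (hZ (measurableSet_singleton i)) measurable_const measurable_const, 1,
    fun ω => ?_⟩
  rw [ind]
  split_ifs <;> simp

lemma isBddRV_centeredLog {Z : Ω → ℕ} (hZ : Measurable Z) (K : ℕ) (p : ℕ → ℝ) :
    IsBddRV (centeredLog K p Z) :=
  IsBddRV.sum fun i _ => ((isBddRV_ind hZ i).sub (.const _)).mul (.const _)

lemma integral_ind (hX : IsIIDSample P n K p X) {k : ℕ} (hk : k ∈ Finset.Icc 1 n) {i : ℕ}
    (hi : i ∈ Finset.Icc 1 K) : ∫ ω, ind (X k) i ω ∂P = p i := by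
  have hm : MeasurableSet {ω | X k ω = i} := hX.measurable k hk (measurableSet_singleton i)
  have e : ind (X k) i = {ω | X k ω = i}.indicator fun _ => (1 : ℝ) := by
    ext ω
    rw [ind, Set.indicator_apply]
    rfl
  rw [e, integral_indicator_const _ hm, hX.law k hk i hi, smul_eq_mul, mul_one]

/-- The prescribed masses already sum to 1, so no other value has positive probability. -/
lemma ae_mem_support [IsProbabilityMeasure P] (hp : IsNonuniformDistribution K p)
    (hX : IsIIDSample P n K p X) :
    ∀ᵐ ω ∂P, ∀ k ∈ Finset.Icc 1 n, X k ω ∈ Finset.Icc 1 K ∧ p (X k ω) ≠ 0 := by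
  rw [ae_all_iff]
  intro k
  by_cases hk : k ∈ Finset.Icc 1 n
  · have hm : ∀ i, MeasurableSet {ω | X k ω = i} := fun i =>
      hX.measurable k hk (measurableSet_singleton i)
    have h1 : P.real (⋃ i ∈ (Finset.Icc 1 K).filter (p · ≠ 0), {ω | X k ω = i}) = 1 := by
      rw [measureReal_biUnion_finset]
      · rw [← hp.sum_eq_one, ← Finset.sum_filter_ne_zero (Finset.Icc 1 K) (f := p)]
        exact Finset.sum_congr rfl fun i hi =>
          hX.law k hk i (Finset.mem_of_mem_filter i hi)
      · intro i _ j _ hij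
        exact Set.disjoint_left.2 fun ω h h' => hij (Eq.trans (Eq.symm h) h')
      · exact fun i _ => hm i
    have h2 : MeasurableSet (⋃ i ∈ (Finset.Icc 1 K).filter (p · ≠ 0), {ω | X k ω = i}) :=
      Finset.measurableSet_biUnion _ fun i _ => hm i
    have h3 : P (⋃ i ∈ (Finset.Icc 1 K).filter (p · ≠ 0), {ω | X k ω = i})ᶜ = 0 := by
      rw [prob_compl_eq_zero_iff h2]
      rw [measureReal_def] at h1
      rwa [ENNReal.toReal_eq_one_iff] at h1
    filter_upwards [measure_eq_zero_iff_ae_notMem.1 h3] with ω hω _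
    simp only [Set.mem_compl_iff, not_not, Set.mem_iUnion] at hω
    obtain ⟨i, hi, rfl⟩ := hω
    exact Finset.mem_filter.1 hi
  · exact Eventually.of_forall fun ω h => absurd h hk

lemma integral_comp_sample [IsProbabilityMeasure P] (hp : IsNonuniformDistribution K p)
    (hX : IsIIDSample P n K p X) {k : ℕ} (hk : k ∈ Finset.Icc 1 n) (G : ℕ → ℝ) :
    ∫ ω, G (X k ω) ∂P = ∑ i ∈ Finset.Icc 1 K, p i * G i := by
  have h1 : ∀ᵐ ω ∂P, G (X k ω) = ∑ i ∈ Finset.Icc 1 K, ind (X k) i ω * G i := by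
    filter_upwards [ae_mem_support hp hX] with ω hω
    simp [ind, (Finset.mem_Icc.1 (hω k hk).1)]
  rw [integral_congr_ae h1, integral_finsetSum _ fun i _ =>
    ((isBddRV_ind (hX.measurable k hk) i).mul (.const _)).integrable]
  refine Finset.sum_congr rfl fun i hi => ?_
  rw [integral_mul_const, integral_ind hX hk hi]

/-- Taking `id` as the sample turns `centeredLog` into a function of the observed value:
`centeredLog K p (X k) ω` is by definition `centeredLog K p id (X k ω)`, so its moments become
finite sums. -/
lemma centeredLog_id_of_mem {i : ℕ} (hi : i ∈ Finset.Icc 1 K) :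
    centeredLog K p id i = Real.log (p i) - ∑ j ∈ Finset.Icc 1 K, p j * Real.log (p j) := by
  simp only [centeredLog, sub_mul, Finset.sum_sub_distrib]
  congr 1
  simp [ind, Finset.mem_Icc.1 hi]

lemma integral_centeredLog [IsProbabilityMeasure P] (hp : IsNonuniformDistribution K p)
    (hX : IsIIDSample P n K p X) {k : ℕ} (hk : k ∈ Finset.Icc 1 n) :
    ∫ ω, centeredLog K p (X k) ω ∂P = 0 := by
  refine (integral_comp_sample hp hX hk (centeredLog K p id)).trans ?_
  rw [Finset.sum_congr rfl fun i hi => by rw [centeredLog_id_of_mem hi, mul_sub],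
    Finset.sum_sub_distrib, ← Finset.sum_mul, hp.sum_eq_one, one_mul, sub_self]

lemma integral_centeredLog_sq [IsProbabilityMeasure P] (hp : IsNonuniformDistribution K p)
    (hX : IsIIDSample P n K p X) (hσ : 0 < sigma K p) {k : ℕ} (hk : k ∈ Finset.Icc 1 n) :
    ∫ ω, centeredLog K p (X k) ω ^ 2 ∂P = sigma K p ^ 2 := by
  refine (integral_comp_sample hp hX hk fun x => centeredLog K p id x ^ 2).trans ?_
  rw [sigma, Real.sq_sqrt (Real.sqrt_pos.1 hσ).le]
  set m := ∑ j ∈ Finset.Icc 1 K, p j * Real.log (p j) with hm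
  have : ∀ i ∈ Finset.Icc 1 K, p i * centeredLog K p id i ^ 2
      = p i * Real.log (p i) ^ 2 - p i * Real.log (p i) * (2 * m) + p i * m ^ 2 := fun i hi => by
    rw [centeredLog_id_of_mem hi]
    ring
  rw [Finset.sum_congr rfl this, Finset.sum_add_distrib, Finset.sum_sub_distrib, ← Finset.sum_mul,
    ← Finset.sum_mul, hp.sum_eq_one, ← hm]
  ring

lemma integral_centeredLog_rpow [IsProbabilityMeasure P] (hp : IsNonuniformDistribution K p)
    (hX : IsIIDSample P n K p X) (s : ℝ) {k l : ℕ} (hk : k ∈ Finset.Icc 1 n)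
    (hl : l ∈ Finset.Icc 1 n) :
    ∫ ω, |centeredLog K p (X k) ω| ^ s ∂P = ∫ ω, |centeredLog K p (X l) ω| ^ s ∂P :=
  (integral_comp_sample hp hX hk fun x => |centeredLog K p id x| ^ s).trans
    (integral_comp_sample hp hX hl fun x => |centeredLog K p id x| ^ s).symm

lemma ae_relEntropy_mem [IsProbabilityMeasure P] (hn : 1 ≤ n) (hp : IsNonuniformDistribution K p)
    (hX : IsIIDSample P n K p X) :
    ∀ᵐ ω ∂P, 0 ≤ relEntropy K (fun i => empirical n X i ω) p ∧
      relEntropy K (fun i => empirical n X i ω) p ≤ chiSq K (fun i => empirical n X i ω) p := by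
  filter_upwards [ae_mem_support hp hX] with ω hω
  have h1 : ∀ i ∈ Finset.Icc 1 K, p i = 0 → empirical n X i ω = 0 := fun i _ hi =>
    empirical_eq_zero (fun k hk => (hω k hk).2) hi
  have h2 : ∑ i ∈ Finset.Icc 1 K, empirical n X i ω = ∑ i ∈ Finset.Icc 1 K, p i := by
    rw [hp.sum_eq_one, sum_empirical hn fun k hk => (hω k hk).1]
  exact ⟨relEntropy_nonneg (fun i _ => empirical_nonneg i ω) hp.nonneg h1 h2,
    relEntropy_le_chiSq (fun i _ => empirical_nonneg i ω) hp.nonneg h1 h2⟩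

lemma isBddRV_empirical (hX : IsIIDSample P n K p X) (i : ℕ) : IsBddRV (empirical n X i) :=
  (IsBddRV.const _).mul (IsBddRV.sum fun j hj => isBddRV_ind (hX.measurable j hj) i)

lemma isBddRV_chiSq (hX : IsIIDSample P n K p X) :
    IsBddRV fun ω => chiSq K (fun i => empirical n X i ω) p :=
  IsBddRV.sum fun i _ => by
    simpa only [div_eq_mul_inv] using
      ((isBddRV_empirical hX i).sub (.const (p i))).sq.mul (.const (p i)⁻¹)

/-- The squared indicators equal the indicators, so the variance of the count is at most `n p i`. -/
lemma integral_empirical_sub_sq_le [IsProbabilityMeasure P] (hn : 1 ≤ n)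
    (hX : IsIIDSample P n K p X) {i : ℕ} (hi : i ∈ Finset.Icc 1 K) :
    ∫ ω, (empirical n X i ω - p i) ^ 2 ∂P ≤ p i / n := by
  have hn' : (0 : ℝ) < n := by positivity
  have hb : ∀ j : Finset.Icc 1 n, IsBddRV (ind (X j) i) := fun j =>
    isBddRV_ind (hX.measurable j j.2) i
  have hind : iIndepFun (fun j : Finset.Icc 1 n => ind (X j) i) P :=
    hX.indep.comp (fun _ x => if x = i then (1 : ℝ) else 0) fun _ => measurable_of_countable _
  have h1 := integral_sum_sub_sq_le (s := Finset.univ) hb hind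
  have hsq : ∀ (j : Finset.Icc 1 n) ω, ind (X j) i ω ^ 2 = ind (X j) i ω := fun j ω => by
    rw [ind]
    split_ifs <;> norm_num
  have hmean : ∑ j : Finset.Icc 1 n, ∫ ω, ind (X j) i ω ∂P = n * p i := by
    rw [Finset.sum_congr rfl fun j _ => integral_ind hX j.2 hi]
    simp
  simp only [hsq, hmean] at h1
  have e : ∀ ω, (empirical n X i ω - p i) ^ 2
      = ((n : ℝ) ^ 2)⁻¹ * (∑ j : Finset.Icc 1 n, ind (X j) i ω - n * p i) ^ 2 := fun ω => by
    rw [empirical, ← Finset.sum_coe_sort (Finset.Icc 1 n) fun j => ind (X j) i ω]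
    field_simp
  simp only [e]
  rw [integral_const_mul]
  calc _ ≤ ((n : ℝ) ^ 2)⁻¹ * (n * p i) := by gcongr
    _ = p i / n := by field_simp

lemma integral_chiSq_le [IsProbabilityMeasure P] (hn : 1 ≤ n) (hp : IsNonuniformDistribution K p)
    (hX : IsIIDSample P n K p X) :
    ∫ ω, chiSq K (fun i => empirical n X i ω) p ∂P ≤ K / n := by
  have hb : ∀ i, IsBddRV fun ω => (empirical n X i ω - p i) ^ 2 := fun i =>
    ((isBddRV_empirical hX i).sub (.const (p i))).sq
  simp only [chiSq]
  rw [integral_finsetSum _ fun i _ => (hb i).integrable.div_const _]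
  have : ∀ i ∈ Finset.Icc 1 K, ∫ ω, (empirical n X i ω - p i) ^ 2 / p i ∂P ≤ 1 / n := by
    intro i hi
    rw [integral_div]
    rcases (hp.nonneg i hi).eq_or_lt with h | h
    -- Points of mass zero contribute nothing, because division by zero gives zero.
    · rw [← h, div_zero]
      positivity
    · rw [div_le_iff₀ h]
      refine (integral_empirical_sub_sq_le hn hX hi).trans_eq ?_
      ring
  refine (Finset.sum_le_sum this).trans_eq ?_
  simp [div_eq_mul_inv]

lemma one_le_card_alphabet (hp : IsNonuniformDistribution K p) : 1 ≤ K := by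
  obtain ⟨i, hi, -⟩ := hp.nonuniform
  exact (Finset.mem_Icc.1 hi).1.trans (Finset.mem_Icc.1 hi).2

end Sample

lemma sq_mul_min_le_rpow {δ : ℝ} (h0 : 0 ≤ δ) (h1 : δ ≤ 1) (x : ℝ) :
    x ^ 2 * min 1 |x| ≤ |x| ^ (2 + δ) := by
  rw [← sq_abs]
  rcases (abs_nonneg x).eq_or_lt with h | h
  · rw [← h]
    simp only [ne_eq, OfNat.ofNat_ne_zero, not_false_eq_true, zero_pow, zero_mul]
    exact Real.rpow_nonneg le_rfl _
  rw [Real.rpow_add h, Real.rpow_two]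
  refine mul_le_mul_of_nonneg_left ?_ (sq_nonneg _)
  rcases le_total 1 |x| with h2 | h2
  · exact (min_le_left _ _).trans (Real.one_le_rpow h2 h0)
  · refine (min_le_right _ _).trans ?_
    simpa using Real.rpow_le_rpow_of_exponent_ge h h2 h1

/-- The normalized sum in the Hájek-type linearization of the plug-in estimator satisfies a
Berry–Esseen bound. -/
lemma berry_esseen_centeredLog [IsProbabilityMeasure P] {n K : ℕ} {p : ℕ → ℝ} {X : ℕ → Ω → ℕ}
    (hn : 1 ≤ n) (hp : IsNonuniformDistribution K p) (hX : IsIIDSample P n K p X)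
    (hσ : 0 < sigma K p) {δ : ℝ} (hδ0 : 0 ≤ δ) (hδ1 : δ ≤ 1) {β : ℝ} (hβ0 : 0 < β)
    (hβ : (∫ ω, |centeredLog K p (X 1) ω| ^ (2 + δ) ∂P)
      / ((n : ℝ) ^ (δ / 2) * sigma K p ^ (2 + δ)) ≤ β) (z : ℝ) :
    |P.real {ω | -((√(n : ℝ) * sigma K p)⁻¹ * ∑ j ∈ Finset.Icc 1 n, centeredLog K p (X j) ω) ≤ z}
      - normalCDF z| ≤ 96 * β := by
  have hn' : (0 : ℝ) < n := by positivity
  set a : ℝ := (√(n : ℝ) * sigma K p)⁻¹ with ha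
  have ha0 : 0 < a := by positivity
  set ξ : Finset.Icc 1 n → Ω → ℝ := fun j ω => -a * centeredLog K p (X j) ω with hξ
  have hTb : ∀ j : Finset.Icc 1 n, IsBddRV (centeredLog K p (X j)) := fun j =>
    isBddRV_centeredLog (hX.measurable j j.2) K p
  have hb : ∀ j, IsBddRV (ξ j) := fun j => (IsBddRV.const (-a)).mul (hTb j)
  have hind : iIndepFun ξ P :=
    hX.indep.comp (fun _ x => -a * centeredLog K p id x) fun _ => measurable_of_countable _
  have h0 : ∀ j, ∫ ω, ξ j ω ∂P = 0 := fun j => by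
    rw [hξ]
    simp only
    rw [integral_const_mul, integral_centeredLog hp hX j.2, mul_zero]
  have h1 : ∑ j, ∫ ω, ξ j ω ^ 2 ∂P = 1 := by
    have : ∀ j ∈ Finset.univ, ∫ ω, ξ j ω ^ 2 ∂P = 1 / n := fun j _ => by
      simp only [hξ, mul_pow, neg_sq]
      rw [integral_const_mul, integral_centeredLog_sq hp hX hσ j.2, ha, inv_pow, mul_pow,
        Real.sq_sqrt hn'.le]
      field_simp
    rw [Finset.sum_congr rfl this]
    simp [hn'.ne']
  have hsum : ∑ j, ∫ ω, ξ j ω ^ 2 * min 1 |ξ j ω| ∂P ≤ β := by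
    refine le_trans ?_ hβ
    -- The `n` identical summands absorb one power of `n` from `√n ^ (2 + δ) = n ^ (1 + δ/2)`.
    have hpow : (n : ℝ) * a ^ (2 + δ) = ((n : ℝ) ^ (δ / 2) * sigma K p ^ (2 + δ))⁻¹ := by
      rw [ha, Real.inv_rpow (by positivity), Real.mul_rpow (Real.sqrt_nonneg _) hσ.le,
        Real.sqrt_eq_rpow, ← Real.rpow_mul hn'.le, mul_inv, mul_inv, ← mul_assoc]
      congr 1
      have : (1 / 2 : ℝ) * (2 + δ) = 1 + δ / 2 := by ring
      rw [this, Real.rpow_add hn', Real.rpow_one]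
      have := Real.rpow_pos_of_pos hn' (δ / 2)
      field_simp
    have hterm : ∀ j ∈ Finset.univ, ∫ ω, ξ j ω ^ 2 * min 1 |ξ j ω| ∂P
        ≤ a ^ (2 + δ) * ∫ ω, |centeredLog K p (X 1) ω| ^ (2 + δ) ∂P := by
      intro j _
      rw [← integral_centeredLog_rpow hp hX (2 + δ) j.2 (Finset.mem_Icc.2 ⟨le_rfl, hn⟩),
        ← integral_const_mul]
      have hpt : ∀ ω, ξ j ω ^ 2 * min 1 |ξ j ω|
          ≤ a ^ (2 + δ) * |centeredLog K p (X j) ω| ^ (2 + δ) := fun ω => by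
        refine (sq_mul_min_le_rpow hδ0 hδ1 _).trans_eq ?_
        simp only [hξ]
        rw [abs_mul, abs_neg, abs_of_pos ha0, Real.mul_rpow ha0.le (abs_nonneg _)]
      have hint : IsBddRV fun ω => |centeredLog K p (X j) ω| ^ (2 + δ) := by
        obtain ⟨C, hC⟩ := (hTb j).bdd
        refine ⟨(hTb j).measurable.abs.pow_const _, C ^ (2 + δ), fun ω => ?_⟩
        rw [abs_of_nonneg (Real.rpow_nonneg (abs_nonneg _) _)]
        exact Real.rpow_le_rpow (abs_nonneg _) (hC ω) (by linarith)
      exact integral_mono ((hb j).sq.mul ((hb j).abs.min_const 1)).integrable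
        ((IsBddRV.const _).mul hint).integrable hpt
    refine (Finset.sum_le_sum hterm).trans_eq ?_
    rw [Finset.sum_const, Finset.card_univ, Fintype.card_coe, Nat.card_Icc, nsmul_eq_mul,
      add_tsub_cancel_right, ← mul_assoc, hpow, inv_mul_eq_div]
  have := berry_esseen hb hind h0 h1 hβ0 hsum z
  have e : ∀ ω, ∑ j, ξ j ω = -(a * ∑ j ∈ Finset.Icc 1 n, centeredLog K p (X j) ω) := fun ω => by
    simp only [hξ]
    rw [← Finset.mul_sum, neg_mul,
      Finset.sum_coe_sort (Finset.Icc 1 n) fun j => centeredLog K p (X j) ω]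
  simpa only [e] using this

end PlugInEntropy

theorem theorem2p2 :
    ∃ C : ℝ, 0 < C ∧
      ∀ (Ω : Type*) [MeasurableSpace Ω] (P : Measure Ω) [IsProbabilityMeasure P]
        (K : ℕ → ℕ) (p : ℕ → ℕ → ℝ) (X : ℕ → ℕ → Ω → ℕ),
        (∀ n : ℕ, 1 ≤ n → PlugInEntropy.IsNonuniformDistribution (K n) (p n)) →
        (∀ n : ℕ, 1 ≤ n → PlugInEntropy.IsIIDSample P n (K n) (p n) (X n)) →
        PlugInEntropy.GrowthCondition K p →
        ∀ δ : ℝ, 0 ≤ δ → δ ≤ 1 →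
        ∀ n : ℕ, 1 ≤ n → 0 < PlugInEntropy.sigma (K n) (p n) →
        ∀ x : ℝ,
          |P.real {ω | √(n : ℝ) / PlugInEntropy.sigma (K n) (p n)
                * (PlugInEntropy.plugIn n (K n) (X n) ω - PlugInEntropy.entropy (K n) (p n)) ≤ x}
              - cdf (gaussianReal 0 1) x|
            ≤ C * ((∫ ω, |PlugInEntropy.centeredLog (K n) (p n) (X n 1) ω| ^ (2 + δ) ∂P)
                  / ((n : ℝ) ^ (δ / 2) * PlugInEntropy.sigma (K n) (p n) ^ (2 + δ))
                + √((K n : ℝ) / (√(n : ℝ) * PlugInEntropy.sigma (K n) (p n)))) := by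
  -- 96 from Berry–Esseen plus 2 from the remainder.
  refine ⟨98, by norm_num, ?_⟩
  intro Ω _ P _ K p X hp hX _ δ hδ0 hδ1 n hn hσ x
  specialize hp n hn
  specialize hX n hn
  generalize K n = K at *
  generalize p n = p at *
  generalize X n = X at *
  have hn' : (0 : ℝ) < n := by positivity
  have hs : √(n : ℝ) * √(n : ℝ) = n := Real.mul_self_sqrt hn'.le
  have hs0 : 0 < √(n : ℝ) := Real.sqrt_pos.2 hn'
  have hK : (0 : ℝ) < K := by exact_mod_cast PlugInEntropy.one_le_card_alphabet hp
  set σ := PlugInEntropy.sigma K p with hσ_def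
  set r : ℝ := K / (√(n : ℝ) * σ) with hr
  have hr0 : 0 < r := by positivity
  set L : ℝ := (∫ ω, |PlugInEntropy.centeredLog K p (X 1) ω| ^ (2 + δ) ∂P)
    / ((n : ℝ) ^ (δ / 2) * σ ^ (2 + δ)) with hL
  have hL0 : 0 ≤ L := by
    refine div_nonneg (integral_nonneg fun ω => ?_) (by positivity)
    exact Real.rpow_nonneg (abs_nonneg _) _
  have hε : 0 < √r := Real.sqrt_pos.2 hr0
  have hc : 0 ≤ √(n : ℝ) / σ := by positivity
  have hBE := PlugInEntropy.berry_esseen_centeredLog hn hp hX hσ hδ0 hδ1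
    -- Adding `√r` ensures the strict positivity of `β` without a lower bound on `L`; the target
    -- bound has this term anyway.
    (β := L + √r) (by positivity) (by linarith)
  have hRε : ∫ ω, √(n : ℝ) / σ * PlugInEntropy.chiSq K
      (fun i => PlugInEntropy.empirical n X i ω) p ∂P ≤ √r ^ 2 := by
    rw [integral_const_mul, Real.sq_sqrt hr0.le]
    refine (mul_le_mul_of_nonneg_left (PlugInEntropy.integral_chiSq_le hn hp hX) hc).trans_eq ?_
    have e : (K : ℝ) / n = K / (√(n : ℝ) * √(n : ℝ)) := by rw [hs]
    rw [hr, e]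
    field_simp
  have hY : ∀ᵐ ω ∂P,
      -((√(n : ℝ) * σ)⁻¹ * ∑ j ∈ Finset.Icc 1 n, PlugInEntropy.centeredLog K p (X j) ω)
        - √(n : ℝ) / σ * PlugInEntropy.chiSq K (fun i => PlugInEntropy.empirical n X i ω) p
        ≤ √(n : ℝ) / σ * (PlugInEntropy.plugIn n K X ω - PlugInEntropy.entropy K p) ∧
      √(n : ℝ) / σ * (PlugInEntropy.plugIn n K X ω - PlugInEntropy.entropy K p)
        ≤ -((√(n : ℝ) * σ)⁻¹ * ∑ j ∈ Finset.Icc 1 n, PlugInEntropy.centeredLog K p (X j) ω) := by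
    filter_upwards [PlugInEntropy.ae_relEntropy_mem hn hp hX] with ω hω
    have e : √(n : ℝ) / σ * (1 / n) = (√(n : ℝ) * σ)⁻¹ := by
      nth_rw 2 [← hs]
      field_simp
    rw [PlugInEntropy.plugIn_sub_entropy hn, ← e, mul_sub, mul_neg, ← mul_assoc]
    have h1 := mul_le_mul_of_nonneg_left hω.2 hc
    have h2 := mul_nonneg hc hω.1
    constructor <;> linarith
  have := PlugInEntropy.abs_measureReal_sub_normalCDF_le
    ((SteinMethod.IsBddRV.const _).mul (PlugInEntropy.isBddRV_chiSq hX))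
    (fun ω => mul_nonneg hc (Finset.sum_nonneg fun i hi =>
      div_nonneg (sq_nonneg _) (hp.nonneg i hi))) hε hRε hY hBE x
  refine this.trans ?_
  linarith
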